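/- Let $\kappa\in\mathbb R$ and $0<\epsilon_R<1$. There is a constant $K=K(\kappa,\epsilon_R)$ such that the following holds. *Problem.* Let $n_b\ge 1$, $N=2^{n_b}$, let $A\in\mathbb C^{N\times N}$ be Hermitian with condition number $\|A\|\,\|A^{-1}\|=\kappa$, eigenvalues $\lambda_j$ and smallest eigenvalue $\lambda_{\min}$, and let $\boldsymbol b\ne 0$ have the entries $b_i=f(x_i)$, $x_i=i/(N-1)$, $0\le i<N$, for a function $f:[0,1]\to\mathbb R$. Let $|x\rangle=A^{-1}\boldsymbol b/\|A^{-1}\boldsymbol b\|$ be the exact normalized solution. *State preparation.* Let $c\in(0,1]$ and let $p$ be a real polynomial with $|f(x)/\|\boldsymbol b\|_\infty-p(x)|\le\epsilon_p$ on $[0,1]$. An ancilla of the equal superposition $N^{-1/2}\sum_i|i\rangle|0\rangle$ is rotated, $|i\rangle|0\rangle\mapsto|i\rangle(\cos(cp(x_i))|0\rangle+\sin(cp(x_i))|1\rangle)$, and measured in $|1\rangle$; the normalized result is $|\tilde b\rangle$. Put $$\epsilon_S=\frac{4\kappa\sqrt N\,\|\boldsymbol b\|_\infty(\epsilon_p+c^2)}{\|\boldsymbol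 b\|}.$$ *Hamiltonian simulation.* Let $A=\sum_{j=1}^J H_j$ with Hermitian $H_j$, let $S_1(s)=\prod_{j=1}^{J}e^{\mathrm iH_js/2}\prod_{j=J}^{1}e^{\mathrm iH_js/2}$ and $V(t,m)=S_1(t/m)^m$. For $0\le k<N_l$ (with $N_l$, $t$ as below) the power $e^{\mathrm iAtk}$ is replaced by $V^k(t,m(k))$, where the numbers $m(k)\ge 1$ of Trotter steps are such that $\|e^{\mathrm iAtk}-V^k(t,m(k))\|\le\epsilon_A$ for all $0\le k<N_l$. *Eigenvalue inversion.* Let $n_l=3\left(\left\lfloor\log_2\left(\tfrac{2(2\kappa^2-\epsilon_R)}{\epsilon_R}+1\right)\right\rfloor+1\right)$, $N_l=2^{n_l}$, $a=2^{2n_l/3}$, and let $t>0$ and $C=N_lt\lambda_{\min}/(2\pi)$ be such that $N_l\lambda_jt/(2\pi)\in[a,N_l-1]$ for all $j$ and $C/x\in(0,1]$ for all $x\in[a,N_l-1]$. Let $p_C$ be the piecewise polynomial which on each interval $[5^ia,5^{i+1}a)$, $i\ge 0$, is the Chebyshev interpolant of degree $d$ of $\arcsin(C/x)$ on $[5^ia,5^{i+1}a]$,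 with $d$ such that $$|\arcsin(C/x)-p_C(x)|\le\epsilon_C=\frac{\epsilon_R}{2(2\kappa^2-\epsilon_R)}\quad\text{for all } x\in[a,N_l-1].$$ *Algorithm.* Starting from $|\tilde b\rangle$, apply quantum phase estimation with an $n_l$-qubit eigenvalue register (Hadamard gates, controlled $V^k(t,m(k))$, inverse quantum Fourier transform); rotate an ancilla, $|0\rangle\mapsto\cos\theta_l|0\rangle+\sin\theta_l|1\rangle$ conditioned on the register state $|l\rangle$, with $\theta_l=p_C(l)$ for $l\ge a$ and $\theta_l=\pi/2$ for $l<a$; apply the inverse of the phase estimation; measure $|1\rangle$ in the ancilla and $|0\rangle$ in the eigenvalue register. Let $|\tilde x\rangle$ be the resulting normalized state of the solution register. Then $$\big\||x\rangle-|\tilde x\rangle\big\|\le\epsilon_S+2\epsilon_A+\epsilon_R+K\epsilon_A^2 .$$ -/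

import Mathlib

open scoped Kronecker Matrix

noncomputable section

namespace HHL

/-! ### Vectors and matrices -/

/-- The spectral (operator) `2`-norm of a square complex matrix. -/
def opNorm {ι : Type*} [Fintype ι] [DecidableEq ι] (M : Matrix ι ι ℂ) : ℝ :=
  ‖Matrix.toEuclideanCLM (n := ι) (𝕜 := ℂ) M‖

/-- The condition number `‖M‖ ‖M⁻¹‖` in the `2`-norm. -/
def condNumber {ι : Type*} [Fintype ι] [DecidableEq ι] (M : Matrix ι ι ℂ) : ℝ :=
  opNorm M * opNorm M⁻¹

/-- The normalized vector `v / ‖v‖` (and `0` if `v = 0`), i.e. the state after a successful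
measurement whose unnormalized outcome is `v`. -/
def normalized {ι : Type*} [Fintype ι] (v : EuclideanSpace ℂ ι) : EuclideanSpace ℂ ι :=
  ((‖v‖⁻¹ : ℝ) : ℂ) • v

/-- The exact normalized solution `|x⟩` of `A x = b`. -/
def exactSolution {ι : Type*} [Fintype ι] [DecidableEq ι] (A : Matrix ι ι ℂ)
    (b : EuclideanSpace ℂ ι) : EuclideanSpace ℂ ι :=
  normalized (WithLp.toLp 2 (A⁻¹ *ᵥ b.ofLp))

/-! ### Gates -/

/-- The `Y`-rotation `|0⟩ ↦ cos θ |0⟩ + sin θ |1⟩`, `|1⟩ ↦ - sin θ |0⟩ + cos θ |1⟩`. -/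
def rotY (θ : ℝ) : Matrix (Fin 2) (Fin 2) ℂ :=
  !![(Real.cos θ : ℂ), -(Real.sin θ : ℂ); (Real.sin θ : ℂ), (Real.cos θ : ℂ)]

/-- The rotation of an ancilla qubit (first factor) by the angle `θ i`, controlled by the basis
state `|i⟩` of the second factor. -/
def controlledRotY {ι : Type*} [DecidableEq ι] (θ : ι → ℝ) :
    Matrix (Fin 2 × ι) (Fin 2 × ι) ℂ :=
  Matrix.blockDiagonal fun i => rotY (θ i)

/-- The `n`-qubit Hadamard gate: the entry at `(k, l)` is `(-1)^(k·l) / √(2^n)`, where `k·l` is the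
number of binary places at which both `k` and `l` have the digit `1`. -/
def hadamard (n : ℕ) : Matrix (Fin (2 ^ n)) (Fin (2 ^ n)) ℂ :=
  Matrix.of fun k l =>
    (-1 : ℂ) ^ (Nat.digits 2 (Nat.land (k : ℕ) (l : ℕ))).sum / (Real.sqrt (2 ^ n) : ℂ)

/-- The `n`-qubit quantum Fourier transform. -/
def qft (n : ℕ) : Matrix (Fin (2 ^ n)) (Fin (2 ^ n)) ℂ :=
  Matrix.of fun k l =>
    Complex.exp (2 * Real.pi * Complex.I * (k : ℕ) * (l : ℕ) / 2 ^ n) / (Real.sqrt (2 ^ n) : ℂ)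

/-! ### Approximate state preparation -/

/-- The grid points `x_i = i / (N - 1)`, `N = 2 ^ nb`. -/
def grid (nb : ℕ) (i : Fin (2 ^ nb)) : ℝ := (i : ℕ) / ((2 : ℝ) ^ nb - 1)

/-- The right-hand side `b`, with entries `f (x_i)`. -/
def rhs (nb : ℕ) (f : ℝ → ℝ) : EuclideanSpace ℂ (Fin (2 ^ nb)) :=
  WithLp.toLp 2 fun i => (f (grid nb i) : ℂ)

/-- The maximum norm `‖b‖_∞` of the right-hand side. -/
def rhsSup (nb : ℕ) (f : ℝ → ℝ) : ℝ := ⨆ i : Fin (2 ^ nb), |f (grid nb i)|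

/-- The equal superposition `N^(-1/2) ∑ i, |0⟩|i⟩` of an ancilla qubit and the solution register. -/
def equalSuperposition (nb : ℕ) : Fin 2 × Fin (2 ^ nb) → ℂ :=
  fun q => if q.1 = 0 then 1 / (Real.sqrt (2 ^ nb) : ℂ) else 0

/-- The state `|b̃⟩` returned by approximate state preparation: the ancilla of the equal
superposition is rotated by the angles `c p(x_i)`, and then measured in the state `|1⟩`. -/
def preparedState (nb : ℕ) (c : ℝ) (p : Polynomial ℝ) : EuclideanSpace ℂ (Fin (2 ^ nb)) :=
  normalized (WithLp.toLp 2 fun i =>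
    (controlledRotY (fun i => c * p.eval (grid nb i)) *ᵥ equalSuperposition nb) (1, i))

/-- The error `ε_S = 4 κ √N ‖b‖_∞ (ε_p + c²) / ‖b‖` of state preparation. -/
def statePrepError (nb : ℕ) (f : ℝ → ℝ) (κ εp c : ℝ) : ℝ :=
  4 * κ * Real.sqrt (2 ^ nb) * rhsSup nb f * (εp + c ^ 2) / ‖rhs nb f‖

/-! ### Trotterized Hamiltonian simulation -/

/-- The exact evolution `exp (i A s)`. -/
def evolution {ι : Type*} [Fintype ι] [DecidableEq ι] (A : Matrix ι ι ℂ) (s : ℝ) :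
    Matrix ι ι ℂ :=
  NormedSpace.exp ((Complex.I * (s : ℂ)) • A)

/-- The second order Lie-Trotter formula
`S₁(s) = e^(i H₁ s/2) ⋯ e^(i H_J s/2) e^(i H_J s/2) ⋯ e^(i H₁ s/2)`. -/
def trotterStep {ι : Type*} [Fintype ι] [DecidableEq ι] {J : ℕ} (H : Fin J → Matrix ι ι ℂ)
    (s : ℝ) : Matrix ι ι ℂ :=
  (List.ofFn fun j => evolution (H j) (s / 2)).prod *
    (List.ofFn fun j => evolution (H j) (s / 2)).reverse.prod

/-- `V(t, m)^k = (S₁(t / m)^m)^k`: the approximation of `exp (i A t k)` that uses `m` Trotter steps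
per time `t`. -/
def trotterPower {ι : Type*} [Fintype ι] [DecidableEq ι] {J : ℕ} (H : Fin J → Matrix ι ι ℂ)
    (t : ℝ) (m k : ℕ) : Matrix ι ι ℂ :=
  (trotterStep H (t / m) ^ m) ^ k

/-! ### Eigenvalue inversion -/

/-- The Chebyshev nodes of degree `d` on `[u, v]`, for `j = 0, …, d`. -/
def chebyshevNode (d : ℕ) (u v : ℝ) (j : ℕ) : ℝ :=
  (u + v) / 2 + (v - u) / 2 * Real.cos ((2 * j + 1) * Real.pi / (2 * (d + 1)))

/-- Chebyshev interpolation of degree `d` of the function `g` on `[u, v]`. -/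
def chebyshevInterpolant (d : ℕ) (u v : ℝ) (g : ℝ → ℝ) : Polynomial ℝ :=
  Lagrange.interpolate (Finset.range (d + 1)) (chebyshevNode d u v)
    fun j => g (chebyshevNode d u v j)

/-- The piecewise polynomial approximation of `x ↦ arcsin (C / x)` for `a ≤ x`: Chebyshev
interpolation of degree `d` on each of the intervals `[5^i a, 5^(i+1) a)`, `i = 0, 1, …`. -/
def inversionAngle (d : ℕ) (a C x : ℝ) : ℝ :=
  (chebyshevInterpolant d (5 ^ Nat.log 5 ⌊x / a⌋₊ * a) (5 ^ (Nat.log 5 ⌊x / a⌋₊ + 1) * a)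
    fun y => Real.arcsin (C / y)).eval x

/-- The angle of the ancilla rotation conditioned on `|l⟩` in the eigenvalue register: the piecewise
polynomial for `a ≤ l`, and a full rotation to `|1⟩` (amplitude `1`) for `l < a`. -/
def rotationAngle (n d : ℕ) (a C : ℝ) (l : Fin (2 ^ n)) : ℝ :=
  if a ≤ ((l : ℕ) : ℝ) then inversionAngle d a C ((l : ℕ) : ℝ) else Real.pi / 2

/-- The integer `⌊log₂ (2 (2 κ² - ε_R) / ε_R + 1)⌋ + 1`, a third of the number of qubits of the
eigenvalue register. -/
def eigBitsThird (κ εR : ℝ) : ℕ :=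
  ⌊Real.logb 2 (2 * (2 * κ ^ 2 - εR) / εR + 1)⌋₊ + 1

/-- The number `n_l` of qubits of the eigenvalue register. -/
def eigBits (κ εR : ℝ) : ℕ := 3 * eigBitsThird κ εR

/-- The left end `a = 2^(2 n_l / 3)` of the range on which the inverse is approximated. -/
def cutoff (κ εR : ℝ) : ℝ := 2 ^ (2 * eigBitsThird κ εR)

/-- The accuracy `ε_C = ε_R / (2 (2 κ² - ε_R))` that is required of the rotation angles. -/
def angleError (κ εR : ℝ) : ℝ := εR / (2 * (2 * κ ^ 2 - εR))

/-- The eigenvalue `lam` on the scale of the eigenvalue register, `N_l lam t / (2 π)`. -/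
def scaledEigenvalue (n : ℕ) (t lam : ℝ) : ℝ := 2 ^ n * lam * t / (2 * Real.pi)

/-- The constant `C = N_l t λ_min / (2 π)`, where `λ_min` is the smallest eigenvalue of `A`. -/
def rotationConstant {ι : Type*} [Fintype ι] [DecidableEq ι] {A : Matrix ι ι ℂ}
    (hA : A.IsHermitian) (n : ℕ) (t : ℝ) : ℝ :=
  scaledEigenvalue n t (⨅ j, hA.eigenvalues j)

/-! ### The full algorithm -/

/-- Quantum phase estimation on the solution register (first factor) and the `n`-qubit eigenvalue
register (second factor), the `k`-th power of the evolution being implemented by `V k`: Hadamard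
gates, controlled powers, inverse quantum Fourier transform. -/
def phaseEstimation {ι : Type*} [Fintype ι] [DecidableEq ι] (n : ℕ) (V : ℕ → Matrix ι ι ℂ) :
    Matrix (ι × Fin (2 ^ n)) (ι × Fin (2 ^ n)) ℂ :=
  ((1 : Matrix ι ι ℂ) ⊗ₖ (qft n)ᴴ) *
    Matrix.blockDiagonal (fun k : Fin (2 ^ n) => V (k : ℕ)) *
    ((1 : Matrix ι ι ℂ) ⊗ₖ hadamard n)

/-- The unitary part of the algorithm, on ancilla, solution and eigenvalue register: phase
estimation, conditioned rotation of the ancilla, inverse phase estimation. -/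
def circuit {ι : Type*} [Fintype ι] [DecidableEq ι] (n : ℕ) (V : ℕ → Matrix ι ι ℂ)
    (θ : Fin (2 ^ n) → ℝ) :
    Matrix (Fin 2 × (ι × Fin (2 ^ n))) (Fin 2 × (ι × Fin (2 ^ n))) ℂ :=
  ((1 : Matrix (Fin 2) (Fin 2) ℂ) ⊗ₖ (phaseEstimation n V)ᴴ) *
    controlledRotY (fun q : ι × Fin (2 ^ n) => θ q.2) *
    ((1 : Matrix (Fin 2) (Fin 2) ℂ) ⊗ₖ phaseEstimation n V)

/-- The normalized state of the solution register that the algorithm returns when it is started with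
`|0⟩ |b⟩ |0⟩`, after the ancilla has been measured in the state `|1⟩` and the eigenvalue register in
the state `|0⟩`. -/
def output {ι : Type*} [Fintype ι] [DecidableEq ι] (n : ℕ) (V : ℕ → Matrix ι ι ℂ)
    (θ : Fin (2 ^ n) → ℝ) (b : EuclideanSpace ℂ ι) : EuclideanSpace ℂ ι :=
  normalized (WithLp.toLp 2 fun i =>
    (circuit n V θ *ᵥ fun q : Fin 2 × (ι × Fin (2 ^ n)) =>
      if q.1 = 0 ∧ q.2.2 = 0 then b q.2.1 else 0) (1, (i, 0)))

/-- The state `|x̃⟩` returned by the full algorithm with approximate state preparation (`c`, `p`),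
Trotterized Hamiltonian simulation (splitting `H`, time `t`, with `m k` Trotter steps for the `k`-th
power) and piecewise polynomial eigenvalue inversion (degree `d`, cutoff `a`, constant `C`). -/
def approxSolution (nb n : ℕ) (c : ℝ) (p : Polynomial ℝ) {J : ℕ}
    (H : Fin J → Matrix (Fin (2 ^ nb)) (Fin (2 ^ nb)) ℂ) (t : ℝ) (m : ℕ → ℕ)
    (d : ℕ) (a C : ℝ) : EuclideanSpace ℂ (Fin (2 ^ nb)) :=
  output n (fun k => trotterPower H t (m k) k) (rotationAngle n d a C) (preparedState nb c p)

end HHL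

end

noncomputable section

namespace HHL

/-! ### Normalization -/

section Normalization

variable {ι : Type*} [Fintype ι]

/-! Up to normalization, the algorithm applies the matrix `∑ l, sin (θ l) • (B lᴴ * B l)`, where `B
l` is the block of phase estimation that leads from `|0⟩` to `|l⟩` in the eigenvalue register
(`output_eq`). For the exact evolution this is a function of `A`: an eigenvector with scaled
eigenvalue `μ` is multiplied by the mean of `sin (θ l)` under the outcome probabilities `|α_l(μ)|²`.
The hypotheses on `C` force `C = a`, so `sin (θ l)` is within `ε_C` of the clipped inverse `a / max
l a`, and the mean should be close to `a / μ`, the factor of the exact solution.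

Only the mean matters, and this is what makes a moderate register suffice. At circular distance `D`
from `μ` the probability is at most `1 / (4 D²)`, so the mean distance is a harmonic sum, linear in
`n_l`, whereas `a = 2^(2 n_l / 3)`. The relative error of every factor is thus at most `κ ε_C +
O(n_l) / a ≤ 21/25 ε_R` (`abs_sum_norm_sq_phaseAmplitude_mul_sub_le`, `mul_angleError_add_le`),
which costs at most `49/50 ε_R` after normalization.

By Parseval and Cauchy–Schwarz, Trotterization moves the unnormalized output by at most `2 ε_A ‖b‖`
(`norm_act_filterMatrix_sub_le`). Normalization amplifies this to `25 κ ε_A`, which the remaining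
`ε_R / 50` and `K ε_A²` absorb by the inequality of arithmetic and geometric means
(`norm_normalized_sub_le_add`). State preparation is split off by comparing with the exact solution
for `|b̃⟩`. -/

theorem norm_normalized {v : EuclideanSpace ℂ ι} (hv : v ≠ 0) : ‖normalized v‖ = 1 := by
  have : ‖v‖ ≠ 0 := norm_ne_zero_iff.2 hv
  rw [normalized, norm_smul, Complex.norm_real, norm_inv, norm_norm, inv_mul_cancel₀ this]

@[simp] theorem normalized_zero : normalized (0 : EuclideanSpace ℂ ι) = 0 := by
  simp [normalized]

theorem norm_normalized_le_one (v : EuclideanSpace ℂ ι) : ‖normalized v‖ ≤ 1 := by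
  rcases eq_or_ne v 0 with rfl | hv
  · simp
  · exact (norm_normalized hv).le

theorem normalized_smul {r : ℝ} (hr : 0 < r) (v : EuclideanSpace ℂ ι) :
    normalized ((r : ℂ) • v) = normalized v := by
  rw [normalized, normalized, norm_smul, Complex.norm_real, Real.norm_eq_abs, abs_of_pos hr,
    smul_smul, ← Complex.ofReal_mul]
  congr 3
  field_simp

theorem norm_normalized_sub_le_two (u v : EuclideanSpace ℂ ι) :
    ‖normalized u - normalized v‖ ≤ 2 := by
  have h := norm_sub_le (normalized u) (normalized v)
  have hu := norm_normalized_le_one u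
  have hv := norm_normalized_le_one v
  linarith

theorem norm_smul_normalized (u : EuclideanSpace ℂ ι) : ((‖u‖ : ℝ) : ℂ) • normalized u = u := by
  rcases eq_or_ne u 0 with rfl | hu
  · simp
  · have : ‖u‖ ≠ 0 := norm_ne_zero_iff.2 hu
    rw [normalized, smul_smul, ← Complex.ofReal_mul, mul_inv_cancel₀ this, Complex.ofReal_one,
      one_smul]

/-- Multiplied by `‖u‖`, the difference becomes `(u - v) + (‖v‖ - ‖u‖) • normalized v`, and each
summand has norm at most `‖u - v‖`. -/
theorem norm_normalized_sub_mul_le (u v : EuclideanSpace ℂ ι) :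
    ‖normalized u - normalized v‖ * ‖u‖ ≤ 2 * ‖u - v‖ := by
  have key : ((‖u‖ : ℝ) : ℂ) • (normalized u - normalized v) =
      (u - v) + (((‖v‖ - ‖u‖ : ℝ) : ℂ)) • normalized v := by
    rw [smul_sub, norm_smul_normalized, Complex.ofReal_sub, sub_smul, norm_smul_normalized]
    abel
  have h1 : ‖((‖u‖ : ℝ) : ℂ) • (normalized u - normalized v)‖ =
      ‖normalized u - normalized v‖ * ‖u‖ := by
    rw [norm_smul, Complex.norm_real, norm_norm, mul_comm]
  rw [← h1, key]
  refine (norm_add_le _ _).trans ?_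
  rw [norm_smul, Complex.norm_real, Real.norm_eq_abs]
  have h2 : |‖v‖ - ‖u‖| ≤ ‖u - v‖ := by
    rw [norm_sub_rev]; exact abs_norm_sub_norm_le v u
  have h3 := norm_normalized_le_one v
  nlinarith [abs_nonneg (‖v‖ - ‖u‖), norm_nonneg (normalized v)]

/-- If `v` is close to `u`, then the chord between the normalized vectors is bounded by the sine of
their angle, up to the factor `2 / √3`. -/
theorem norm_normalized_sub_le_of_sq_le {u v : EuclideanSpace ℂ ι} {s : ℝ} (hs0 : 0 ≤ s)
    (hs1 : s ≤ 1) (h : ‖u - v‖ ^ 2 ≤ 3 / 4 * s ^ 2 * ‖u‖ ^ 2) :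
    ‖normalized u - normalized v‖ ≤ s := by
  rcases eq_or_ne u 0 with rfl | hu
  · have : ‖(0 : EuclideanSpace ℂ ι) - v‖ = 0 := by
      have := norm_nonneg ((0 : EuclideanSpace ℂ ι) - v)
      simp only [norm_zero] at h
      nlinarith
    have hv : v = 0 := by simpa using this
    simp [hv, hs0]
  have hupos : 0 < ‖u‖ := norm_pos_iff.2 hu
  have hs2 : s ^ 2 ≤ 1 := by nlinarith
  have hv : v ≠ 0 := by
    rintro rfl
    rw [sub_zero] at h
    nlinarith [pow_pos hupos 2]
  have hvpos : 0 < ‖v‖ := norm_pos_iff.2 hv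
  set x : ℝ := RCLike.re (inner ℂ u v) with hx
  have h1 : ‖u - v‖ ^ 2 = ‖u‖ ^ 2 - 2 * x + ‖v‖ ^ 2 := norm_sub_sq (𝕜 := ℂ) u v
  have h2 : ‖normalized u - normalized v‖ ^ 2 = 1 - 2 * (‖u‖⁻¹ * ‖v‖⁻¹ * x) + 1 := by
    rw [norm_sub_sq (𝕜 := ℂ), norm_normalized hu, norm_normalized hv]
    simp only [normalized, inner_smul_left, inner_smul_right, Complex.conj_ofReal, one_pow]
    rw [← mul_assoc, ← Complex.ofReal_mul, hx]
    congr 2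
    rw [mul_comm ‖u‖⁻¹]
    exact congrArg (2 * ·) (Complex.re_ofReal_mul _ _)
  have h3 : (1 - s ^ 2 / 2) * (‖u‖ * ‖v‖) ≤ x := by
    have h4 : (1 - 3 / 4 * s ^ 2) * ‖u‖ ^ 2 + ‖v‖ ^ 2 ≤ 2 * x := by nlinarith
    -- The square is `1 - s² + s⁴ / 4`; the bound `s ≤ 1` is what permits the constant `3/4`. The
    -- inner product is then bounded below by completing a square in `‖u‖` and `‖v‖`.
    have h5 : (1 - s ^ 2 / 2) ^ 2 ≤ 1 - 3 / 4 * s ^ 2 := by nlinarith [sq_nonneg s]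
    have h6 := mul_le_mul_of_nonneg_right h5 (sq_nonneg ‖u‖)
    nlinarith [sq_nonneg ((1 - s ^ 2 / 2) * ‖u‖ - ‖v‖)]
  have h4 : 1 - s ^ 2 / 2 ≤ ‖u‖⁻¹ * ‖v‖⁻¹ * x := by
    rw [← mul_inv, inv_mul_eq_div, le_div_iff₀ (by positivity)]
    exact h3
  exact abs_le_of_sq_le_sq' (by rw [h2]; linarith) hs0 |>.2

end Normalization

/-! ### Linear systems -/

section Matrices

variable {ι : Type*} [Fintype ι] [DecidableEq ι]

theorem norm_mulVec_le (M : Matrix ι ι ℂ) (v : EuclideanSpace ℂ ι) :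
    ‖(WithLp.toLp 2 (M *ᵥ v.ofLp) : EuclideanSpace ℂ ι)‖ ≤ opNorm M * ‖v‖ :=
  (Matrix.toEuclideanCLM (n := ι) (𝕜 := ℂ) M).le_opNorm v

theorem opNorm_nonneg (M : Matrix ι ι ℂ) : 0 ≤ opNorm M := norm_nonneg _

/-- The relative sensitivity of the normalized solution is at most twice the condition number. -/
theorem norm_exactSolution_sub_mul_le {A : Matrix ι ι ℂ} (hA : IsUnit A.det)
    (b w : EuclideanSpace ℂ ι) :
    ‖exactSolution A b - exactSolution A w‖ * ‖b‖ ≤ 2 * condNumber A * ‖b - w‖ := by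
  set x : EuclideanSpace ℂ ι := WithLp.toLp 2 (A⁻¹ *ᵥ b.ofLp) with hx
  set y : EuclideanSpace ℂ ι := WithLp.toLp 2 (A⁻¹ *ᵥ w.ofLp) with hy
  have h1 : ‖exactSolution A b - exactSolution A w‖ * ‖x‖ ≤ 2 * ‖x - y‖ :=
    norm_normalized_sub_mul_le x y
  have h2 : ‖b‖ ≤ opNorm A * ‖x‖ := by
    have := norm_mulVec_le A x
    rw [hx] at this
    simpa [Matrix.mulVec_mulVec, Matrix.mul_nonsing_inv _ hA] using this
  have h3 : ‖x - y‖ ≤ opNorm A⁻¹ * ‖b - w‖ := by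
    have := norm_mulVec_le A⁻¹ (b - w)
    rwa [WithLp.ofLp_sub, Matrix.mulVec_sub, WithLp.toLp_sub] at this
  calc ‖exactSolution A b - exactSolution A w‖ * ‖b‖
      ≤ ‖exactSolution A b - exactSolution A w‖ * (opNorm A * ‖x‖) := by gcongr
    _ = opNorm A * (‖exactSolution A b - exactSolution A w‖ * ‖x‖) := by ring
    _ ≤ opNorm A * (2 * (opNorm A⁻¹ * ‖b - w‖)) :=
        mul_le_mul_of_nonneg_left (h1.trans (by gcongr)) (opNorm_nonneg A)
    _ = 2 * condNumber A * ‖b - w‖ := by rw [condNumber]; ring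

theorem exactSolution_smul (A : Matrix ι ι ℂ) {r : ℝ} (hr : 0 < r) (b : EuclideanSpace ℂ ι) :
    exactSolution A ((r : ℂ) • b) = exactSolution A b := by
  rw [exactSolution, exactSolution, WithLp.ofLp_smul, Matrix.mulVec_smul, WithLp.toLp_smul,
    normalized_smul hr]

theorem exactSolution_normalized (A : Matrix ι ι ℂ) (b : EuclideanSpace ℂ ι) :
    exactSolution A (normalized b) = exactSolution A b := by
  rcases eq_or_ne b 0 with rfl | hb
  · simp
  · exact exactSolution_smul A (inv_pos.2 (norm_pos_iff.2 hb)) b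

end Matrices

/-! ### State preparation -/

theorem abs_sin_sub_self_le (x : ℝ) : |Real.sin x - x| ≤ |x| ^ 3 / 6 := by
  have key : ∀ y : ℝ, 0 ≤ y → |Real.sin y - y| ≤ y ^ 3 / 6 := by
    intro y hy
    rcases hy.eq_or_lt with rfl | hy
    · simp
    · rw [abs_le]
      exact ⟨by linarith [Real.sin_gt_sub_cube hy],
        by linarith [Real.sin_le hy.le, pow_pos hy 3]⟩
  rcases le_total 0 x with hx | hx
  · rw [abs_of_nonneg hx]; exact key x hx
  · have := key (-x) (by linarith)
    rwa [Real.sin_neg, ← abs_neg, neg_sub_neg, neg_sub, abs_sub_comm, ← abs_of_nonpos hx,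
      abs_sub_comm] at this

/-- The cubic remainder of the sine, divided by `c`, is at most `c² |y|³ / 6`, and `(3/2)³ < 6`. The
range `3/2` is `1` for the scaled data plus `1/2` for the polynomial error. -/
theorem abs_sin_mul_div_sub_le {c y : ℝ} (hc : 0 < c) (hy : |y| ≤ 3 / 2) :
    |Real.sin (c * y) / c - y| ≤ c ^ 2 := by
  have h := abs_sin_sub_self_le (c * y)
  have h1 : Real.sin (c * y) / c - y = (Real.sin (c * y) - c * y) / c := by field_simp
  rw [h1, abs_div, abs_of_pos hc, div_le_iff₀ hc]
  refine h.trans ?_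
  rw [abs_mul, abs_of_pos hc, mul_pow]
  have h2 : |y| ^ 3 ≤ (3 / 2) ^ 3 := by gcongr
  nlinarith [pow_pos hc 3]

theorem grid_mem_Icc {nb : ℕ} (hnb : 1 ≤ nb) (i : Fin (2 ^ nb)) : grid nb i ∈ Set.Icc (0 : ℝ) 1 := by
  have h1 : (1 : ℝ) < 2 ^ nb := one_lt_pow₀ one_lt_two (by omega)
  have h2 : ((i : ℕ) : ℝ) + 1 ≤ 2 ^ nb := by exact_mod_cast i.isLt
  rw [grid]
  exact ⟨div_nonneg (Nat.cast_nonneg _) (by linarith), (div_le_one (by linarith)).2 (by linarith)⟩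

theorem abs_le_rhsSup (nb : ℕ) (f : ℝ → ℝ) (i : Fin (2 ^ nb)) : |f (grid nb i)| ≤ rhsSup nb f :=
  le_ciSup (f := fun i : Fin (2 ^ nb) => |f (grid nb i)|) (Set.finite_range _).bddAbove i

theorem rhsSup_pos {nb : ℕ} {f : ℝ → ℝ} (h : rhs nb f ≠ 0) : 0 < rhsSup nb f := by
  by_contra! hle
  refine h ?_
  ext i
  have := (abs_le_rhsSup nb f i).trans hle
  simp [rhs, abs_nonpos_iff.1 this]

theorem norm_le_sqrt_mul {n : ℕ} (v : EuclideanSpace ℂ (Fin n)) {B : ℝ} (hB : 0 ≤ B)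
    (h : ∀ i, ‖v i‖ ≤ B) : ‖v‖ ≤ Real.sqrt n * B := by
  rw [EuclideanSpace.norm_eq]
  refine Real.sqrt_le_iff.2 ⟨by positivity, ?_⟩
  rw [mul_pow, Real.sq_sqrt (Nat.cast_nonneg n)]
  refine (Finset.sum_le_card_nsmul _ _ (B ^ 2) fun i _ => ?_).trans (by simp)
  have := h i
  gcongr

/-- The amplitudes `sin (c p(x_i)) / c`, which are proportional to the prepared state. -/
def sineVector (nb : ℕ) (c : ℝ) (p : Polynomial ℝ) : EuclideanSpace ℂ (Fin (2 ^ nb)) :=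
  WithLp.toLp 2 fun i => ((Real.sin (c * p.eval (grid nb i)) / c : ℝ) : ℂ)

/-- The measured amplitudes are `c / √N` times `sineVector`, and normalization forgets a positive
factor. -/
theorem preparedState_eq (nb : ℕ) {c : ℝ} (hc : 0 < c) (p : Polynomial ℝ) :
    preparedState nb c p = normalized (sineVector nb c p) := by
  have hN : (0 : ℝ) < Real.sqrt (2 ^ nb) := by positivity
  rw [preparedState, ← normalized_smul (div_pos hc hN) (sineVector nb c p)]
  congr 1
  ext i
  have hcc : (c : ℂ) ≠ 0 := by exact_mod_cast hc.ne'
  simp only [sineVector, PiLp.smul_apply, smul_eq_mul, Matrix.mulVec, dotProduct,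
    Fintype.sum_prod_type, Fin.sum_univ_two, controlledRotY, Matrix.blockDiagonal_apply,
    equalSuperposition]
  simp [rotY]
  field_simp

theorem norm_exactSolution_sub_preparedState_le {nb : ℕ} (hnb : 1 ≤ nb)
    {A : Matrix (Fin (2 ^ nb)) (Fin (2 ^ nb)) ℂ} (hA : IsUnit A.det) (hκ : 1 ≤ condNumber A)
    {f : ℝ → ℝ} (hf : rhs nb f ≠ 0) {p : Polynomial ℝ} {εp c : ℝ}
    (hp : ∀ x ∈ Set.Icc (0 : ℝ) 1, |f x / rhsSup nb f - p.eval x| ≤ εp) (hc : 0 < c) :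
    ‖exactSolution A (rhs nb f) - exactSolution A (preparedState nb c p)‖ ≤
      statePrepError nb f (condNumber A) εp c := by
  set κ := condNumber A with hκdef
  have hB := rhsSup_pos hf
  have hb : 0 < ‖rhs nb f‖ := norm_pos_iff.2 hf
  have hεp : 0 ≤ εp := (abs_nonneg _).trans (hp 0 (by simp))
  have hε : 0 < εp + c ^ 2 := by positivity
  rw [preparedState_eq nb hc, exactSolution_normalized, statePrepError]
  have hbnorm : ‖rhs nb f‖ ≤ Real.sqrt (2 ^ nb) * rhsSup nb f := by
    have := norm_le_sqrt_mul (rhs nb f) hB.le fun i => by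
      simpa [rhs] using abs_le_rhsSup nb f i
    simpa using this
  have hratio : 1 ≤ Real.sqrt (2 ^ nb) * rhsSup nb f / ‖rhs nb f‖ := (one_le_div hb).2 hbnorm
  have hrw : 4 * κ * Real.sqrt (2 ^ nb) * rhsSup nb f * (εp + c ^ 2) / ‖rhs nb f‖ =
      4 * (κ * (Real.sqrt (2 ^ nb) * rhsSup nb f / ‖rhs nb f‖)) * (εp + c ^ 2) := by ring
  -- For `ε_p + c² ≥ 1/2` the claimed bound is at least `4 · 1/2 = 2`, the trivial distance of two
  -- normalized vectors. Otherwise `|p| ≤ 3/2` on the grid.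
  rcases le_or_gt (1 / 2) (εp + c ^ 2) with hlarge | hsmall
  · refine (norm_normalized_sub_le_two _ _).trans ?_
    rw [hrw]
    have : 1 ≤ κ * (Real.sqrt (2 ^ nb) * rhsSup nb f / ‖rhs nb f‖) :=
      one_le_mul_of_one_le_of_one_le hκ hratio
    nlinarith
  have hentry : ∀ i, ‖((rhs nb f) - ((rhsSup nb f : ℝ) : ℂ) • sineVector nb c p) i‖ ≤
      rhsSup nb f * (εp + c ^ 2) := by
    intro i
    have h1 := hp _ (grid_mem_Icc hnb i)
    set y := p.eval (grid nb i) with hy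
    have h2 : |f (grid nb i) / rhsSup nb f| ≤ 1 := by
      rw [abs_div, abs_of_pos hB, div_le_one hB]; exact abs_le_rhsSup nb f i
    have h3 : |y| ≤ 3 / 2 := by
      have := abs_sub_abs_le_abs_sub y (f (grid nb i) / rhsSup nb f)
      rw [abs_sub_comm] at this
      nlinarith [sq_nonneg c]
    have h4 := abs_sin_mul_div_sub_le hc h3
    have h5 : ((rhs nb f) - ((rhsSup nb f : ℝ) : ℂ) • sineVector nb c p) i =
        ((rhsSup nb f * ((f (grid nb i) / rhsSup nb f - y) - (Real.sin (c * y) / c - y)) : ℝ) : ℂ)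
        := by
      have : rhsSup nb f * ((f (grid nb i) / rhsSup nb f - y) - (Real.sin (c * y) / c - y)) =
          f (grid nb i) - rhsSup nb f * (Real.sin (c * y) / c) := by
        field_simp; ring
      rw [this]
      simp [rhs, sineVector, hy]
    rw [h5, Complex.norm_real, Real.norm_eq_abs, abs_mul, abs_of_pos hB]
    gcongr
    exact (abs_sub _ _).trans (add_le_add h1 h4)
  have hdiff := norm_le_sqrt_mul _ (by positivity) hentry
  have hmain := norm_exactSolution_sub_mul_le hA (rhs nb f)
    (((rhsSup nb f : ℝ) : ℂ) • sineVector nb c p)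
  rw [exactSolution_smul A hB] at hmain
  have hκ0 : 0 ≤ κ := by linarith
  rw [le_div_iff₀ hb]
  refine hmain.trans ?_
  rw [Nat.cast_pow, Nat.cast_ofNat] at hdiff
  calc 2 * κ * _ ≤ 2 * κ * (Real.sqrt (2 ^ nb) * (rhsSup nb f * (εp + c ^ 2))) := by gcongr
    _ = 2 * (κ * Real.sqrt (2 ^ nb) * rhsSup nb f * (εp + c ^ 2)) := by ring
    _ ≤ 4 * (κ * Real.sqrt (2 ^ nb) * rhsSup nb f * (εp + c ^ 2)) := by
        have : 0 ≤ κ * Real.sqrt (2 ^ nb) * rhsSup nb f * (εp + c ^ 2) := by positivity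
        linarith
    _ = _ := by ring

/-! ### The discrete Fourier transform -/

/-- The entries `e^(-2πi k l / 2^n)` of the unnormalized discrete Fourier transform. -/
def fourierKernel (n : ℕ) (k l : Fin (2 ^ n)) : ℂ :=
  Complex.exp (-(2 * Real.pi * Complex.I * (k : ℕ) * (l : ℕ) / 2 ^ n))

theorem conj_fourierKernel (n : ℕ) (k l : Fin (2 ^ n)) :
    (starRingEnd ℂ) (fourierKernel n k l) =
      Complex.exp (2 * Real.pi * Complex.I * (k : ℕ) * (l : ℕ) / 2 ^ n) := by
  rw [fourierKernel, ← Complex.exp_conj]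
  have h2 : (starRingEnd ℂ) 2 = 2 := map_ofNat _ 2
  congr 1
  simp [h2, neg_div]

/-- A geometric sum over a `2^n`-th root of unity, which equals `1` only if `2^n` divides `k - k'`,
that is, if `k = k'`. -/
theorem sum_conj_fourierKernel_mul (n : ℕ) (k k' : Fin (2 ^ n)) :
    ∑ l, (starRingEnd ℂ) (fourierKernel n k l) * fourierKernel n k' l =
      if k = k' then 2 ^ n else 0 := by
  have hN : (2 : ℂ) ^ n ≠ 0 := pow_ne_zero _ two_ne_zero
  set z : ℂ := Complex.exp (2 * Real.pi * Complex.I * (((k : ℕ) : ℤ) - ((k' : ℕ) : ℤ) : ℤ) / 2 ^ n)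
    with hz
  have hterm : ∀ l : Fin (2 ^ n), (starRingEnd ℂ) (fourierKernel n k l) * fourierKernel n k' l =
      z ^ (l : ℕ) := by
    intro l
    rw [conj_fourierKernel, fourierKernel, ← Complex.exp_add, hz, ← Complex.exp_nat_mul]
    congr 1
    push_cast
    ring
  simp_rw [hterm]
  rw [Fin.sum_univ_eq_sum_range (fun l => z ^ l)]
  split_ifs with h
  · have : z = 1 := by simp [hz, h]
    simp [this]
  · have hz1 : z ≠ 1 := by
      intro h1
      obtain ⟨j, hj⟩ := Complex.exp_eq_one_iff.1 h1
      have hpi : (2 * Real.pi * Complex.I : ℂ) ≠ 0 := Complex.two_pi_I_ne_zero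
      have h2 : (((k : ℕ) : ℤ) - ((k' : ℕ) : ℤ) : ℤ) = (j * 2 ^ n : ℂ) := by
        rw [div_eq_iff hN] at hj
        apply mul_left_cancel₀ hpi
        rw [hj]; ring
      have h3 : ((k : ℕ) : ℤ) - ((k' : ℕ) : ℤ) = j * 2 ^ n := by exact_mod_cast h2
      have hk : ((k : ℕ) : ℤ) < 2 ^ n := by exact_mod_cast k.isLt
      have hk' : ((k' : ℕ) : ℤ) < 2 ^ n := by exact_mod_cast k'.isLt
      have h4 : ((k : ℕ) : ℤ) - ((k' : ℕ) : ℤ) = 0 := by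
        apply Int.eq_zero_of_abs_lt_dvd (m := 2 ^ n) ⟨j, by rw [h3, mul_comm]⟩
        rw [abs_lt]
        constructor <;> linarith [Int.natCast_nonneg (k : ℕ), Int.natCast_nonneg (k' : ℕ)]
      exact h (Fin.ext (by omega))
    have hzN : z ^ (2 ^ n) = 1 := by
      rw [hz, ← Complex.exp_nat_mul, Complex.exp_eq_one_iff]
      refine ⟨((k : ℕ) : ℤ) - ((k' : ℕ) : ℤ), ?_⟩
      push_cast
      field_simp
    rw [geom_sum_eq hz1, hzN, sub_self, zero_div]

/-- Parseval's identity for the discrete Fourier transform of a vector-valued sequence. -/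
theorem sum_norm_sq_fourier {E : Type*} [NormedAddCommGroup E] [InnerProductSpace ℂ E] (n : ℕ)
    (v : Fin (2 ^ n) → E) :
    ∑ l, ‖((2 : ℂ) ^ n)⁻¹ • ∑ k, fourierKernel n k l • v k‖ ^ 2 =
      ((2 : ℝ) ^ n)⁻¹ * ∑ k, ‖v k‖ ^ 2 := by
  have key : ∑ l, inner ℂ (∑ k, fourierKernel n k l • v k) (∑ k, fourierKernel n k l • v k) =
      (2 : ℂ) ^ n * ∑ k, inner ℂ (v k) (v k) := by
    simp_rw [sum_inner, inner_sum, inner_smul_left, inner_smul_right, ← mul_assoc]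
    rw [Finset.sum_comm, Finset.mul_sum]
    refine Finset.sum_congr rfl fun k _ => ?_
    rw [Finset.sum_comm]
    simp_rw [← Finset.sum_mul, sum_conj_fourierKernel_mul]
    simp
  have key' : ∑ l, ‖∑ k, fourierKernel n k l • v k‖ ^ 2 = (2 : ℝ) ^ n * ∑ k, ‖v k‖ ^ 2 := by
    simp_rw [inner_self_eq_norm_sq_to_K] at key
    apply Complex.ofReal_injective
    push_cast
    exact key
  simp_rw [norm_smul, mul_pow]
  rw [← Finset.mul_sum, key', norm_inv, norm_pow, Complex.norm_ofNat]
  have : (2 : ℝ) ^ n ≠ 0 := by positivity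
  field_simp

/-! ### The output of the algorithm -/

section Circuit

variable {ι : Type*} [Fintype ι] [DecidableEq ι]

/-- The operator by which the solution register is transformed if the eigenvalue register goes from
`|0⟩` to `|l⟩` in phase estimation. -/
def phaseBlock (n : ℕ) (V : ℕ → Matrix ι ι ℂ) (l : Fin (2 ^ n)) : Matrix ι ι ℂ :=
  ((2 : ℂ) ^ n)⁻¹ • ∑ k : Fin (2 ^ n), fourierKernel n k l • V k

/-- The operator that the algorithm applies to the solution register, up to normalization. -/
def filterMatrix (n : ℕ) (V : ℕ → Matrix ι ι ℂ) (θ : Fin (2 ^ n) → ℝ) : Matrix ι ι ℂ :=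
  ∑ l, (Real.sin (θ l) : ℂ) • ((phaseBlock n V l)ᴴ * phaseBlock n V l)

theorem hadamard_apply_zero (n : ℕ) (k : Fin (2 ^ n)) :
    hadamard n k 0 = 1 / (Real.sqrt (2 ^ n) : ℂ) := by
  simp [hadamard]

/-- On `|0⟩` the Hadamard gates give the constant amplitude `1 / √N`; with the factor `1 / √N` of
the Fourier transform this makes the prefactor `1 / N`. -/
theorem phaseEstimation_apply_zero (n : ℕ) (V : ℕ → Matrix ι ι ℂ) (i j : ι) (l : Fin (2 ^ n)) :
    phaseEstimation n V (i, l) (j, 0) = phaseBlock n V l i j := by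
  have hs : (Real.sqrt (2 ^ n) : ℂ) * (Real.sqrt (2 ^ n) : ℂ) = 2 ^ n := by
    rw [← Complex.ofReal_mul, Real.mul_self_sqrt (by positivity)]
    push_cast; rfl
  have hconj : ∀ k, (starRingEnd ℂ) (qft n k l) = fourierKernel n k l / (Real.sqrt (2 ^ n) : ℂ) := by
    intro k
    rw [← Complex.conj_conj (fourierKernel n k l), conj_fourierKernel]
    simp [qft]
  have hl : ∀ k : Fin (2 ^ n), ∀ i' : ι,
      (((1 : Matrix ι ι ℂ) ⊗ₖ (qft n)ᴴ) *
        Matrix.blockDiagonal (fun k : Fin (2 ^ n) => V (k : ℕ))) (i, l) (i', k) =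
      fourierKernel n k l / (Real.sqrt (2 ^ n) : ℂ) * V k i i' := by
    intro k i'
    rw [Matrix.mul_apply, Fintype.sum_prod_type, Finset.sum_eq_single i, Finset.sum_eq_single k]
    · simp [Matrix.kroneckerMap_apply, Matrix.blockDiagonal_apply, hconj]
    · intro b _ hb
      simp [Matrix.blockDiagonal_apply, hb]
    · simp
    · intro b _ hb
      simp [Matrix.kroneckerMap_apply, Matrix.one_apply_ne' hb]
    · simp
  rw [phaseEstimation, Matrix.mul_apply, Fintype.sum_prod_type, Finset.sum_eq_single j]
  · simp_rw [hl, Matrix.kroneckerMap_apply, hadamard_apply_zero, Matrix.one_apply_eq, phaseBlock,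
      Matrix.smul_apply, Matrix.sum_apply, Matrix.smul_apply, smul_eq_mul, ← hs]
    rw [Finset.mul_sum]
    refine Finset.sum_congr rfl fun k _ => ?_
    rw [mul_inv]
    ring
  · intro b _ hb
    simp [Matrix.kroneckerMap_apply, Matrix.one_apply_ne hb]
  · simp

theorem kronecker_mul_controlledRotY_mul_apply {σ : Type*} [Fintype σ] [DecidableEq σ]
    (B P : Matrix σ σ ℂ) (θ : σ → ℝ) (x y : σ) :
    (((1 : Matrix (Fin 2) (Fin 2) ℂ) ⊗ₖ B) * controlledRotY θ *
      ((1 : Matrix (Fin 2) (Fin 2) ℂ) ⊗ₖ P)) (1, x) (0, y) =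
      ∑ z, B x z * (Real.sin (θ z) : ℂ) * P z y := by
  simp only [Matrix.mul_apply, Fintype.sum_prod_type, Fin.sum_univ_two, Matrix.kroneckerMap_apply,
    controlledRotY, Matrix.blockDiagonal_apply]
  simp [rotY]

/-- The ancilla passes from `|0⟩` to `|1⟩` with amplitude `sin (θ l)`, while the eigenvalue register
passes from `|0⟩` to `|l⟩` and back to `|0⟩`, which contributes a block and its adjoint. -/
theorem output_eq (n : ℕ) (V : ℕ → Matrix ι ι ℂ) (θ : Fin (2 ^ n) → ℝ) (b : EuclideanSpace ℂ ι) :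
    output n V θ b = normalized (WithLp.toLp 2 (filterMatrix n V θ *ᵥ b.ofLp)) := by
  rw [output]
  congr 2
  funext i
  have hentry : ∀ j, circuit n V θ (1, (i, 0)) (0, (j, 0)) = filterMatrix n V θ i j := by
    intro j
    rw [circuit, kronecker_mul_controlledRotY_mul_apply, Fintype.sum_prod_type, Finset.sum_comm,
      filterMatrix, Matrix.sum_apply]
    refine Finset.sum_congr rfl fun l _ => ?_
    rw [Matrix.smul_apply, Matrix.mul_apply, smul_eq_mul, Finset.mul_sum]
    refine Finset.sum_congr rfl fun i' _ => ?_
    rw [Matrix.conjTranspose_apply, Matrix.conjTranspose_apply, phaseEstimation_apply_zero,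
      phaseEstimation_apply_zero]
    ring
  rw [Matrix.mulVec, dotProduct, Matrix.mulVec, dotProduct, Fintype.sum_prod_type,
    Fin.sum_univ_two]
  simp only [Fintype.sum_prod_type]
  simp only [true_and, one_ne_zero, false_and, if_false, mul_zero, Finset.sum_const_zero, add_zero]
  refine Finset.sum_congr rfl fun j _ => ?_
  rw [Finset.sum_eq_single 0]
  · simp [hentry]
  · intro l _ hl
    simp [hl]
  · simp

/-! ### Perturbation of the evolution -/

/-- The action of a matrix on `EuclideanSpace`. -/
abbrev act (M : Matrix ι ι ℂ) : EuclideanSpace ℂ ι →L[ℂ] EuclideanSpace ℂ ι :=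
  Matrix.toEuclideanCLM (n := ι) (𝕜 := ℂ) M

theorem act_conjTranspose (M : Matrix ι ι ℂ) (x y : EuclideanSpace ℂ ι) :
    inner ℂ x (act Mᴴ y) = inner ℂ (act M x) y := by
  have : act Mᴴ = ContinuousLinearMap.adjoint (act M) := by
    rw [act, ← Matrix.star_eq_conjTranspose, map_star]; rfl
  rw [this, ContinuousLinearMap.adjoint_inner_right]

theorem norm_act_of_mem_unitary {M : Matrix ι ι ℂ} (hM : M ∈ unitary (Matrix ι ι ℂ))
    (x : EuclideanSpace ℂ ι) : ‖act M x‖ = ‖x‖ := by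
  have h : inner ℂ (act M x) (act M x) = inner ℂ x x := by
    rw [← act_conjTranspose, ← mul_apply_eq_comp, act, act, ← map_mul,
      ← Matrix.star_eq_conjTranspose, Unitary.star_mul_self_of_mem hM, map_one,
      one_apply_eq_self]
  rw [inner_self_eq_norm_sq_to_K, inner_self_eq_norm_sq_to_K] at h
  have h' : ‖act M x‖ ^ 2 = ‖x‖ ^ 2 := by exact_mod_cast h
  exact (sq_eq_sq₀ (norm_nonneg _) (norm_nonneg _)).1 h'

theorem act_phaseBlock (n : ℕ) (V : ℕ → Matrix ι ι ℂ) (l : Fin (2 ^ n)) (x : EuclideanSpace ℂ ι) :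
    act (phaseBlock n V l) x =
      ((2 : ℂ) ^ n)⁻¹ • ∑ k : Fin (2 ^ n), fourierKernel n k l • act (V k) x := by
  simp [act, phaseBlock, map_smul, map_sum]

theorem sum_norm_sq_act_phaseBlock (n : ℕ) (V : ℕ → Matrix ι ι ℂ) (x : EuclideanSpace ℂ ι) :
    ∑ l, ‖act (phaseBlock n V l) x‖ ^ 2 =
      ((2 : ℝ) ^ n)⁻¹ * ∑ k : Fin (2 ^ n), ‖act (V k) x‖ ^ 2 := by
  simp_rw [act_phaseBlock]
  exact sum_norm_sq_fourier n fun k => act (V k) x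

theorem sum_norm_sq_act_phaseBlock_le (n : ℕ) (V : ℕ → Matrix ι ι ℂ) (x : EuclideanSpace ℂ ι)
    {B : ℝ} (h : ∀ k : Fin (2 ^ n), opNorm (V k) ≤ B) :
    ∑ l, ‖act (phaseBlock n V l) x‖ ^ 2 ≤ (B * ‖x‖) ^ 2 := by
  rw [sum_norm_sq_act_phaseBlock, inv_mul_le_iff₀ (by positivity)]
  refine (Finset.sum_le_card_nsmul _ _ ((B * ‖x‖) ^ 2) fun k _ => ?_).trans (by simp)
  have : ‖act (V k) x‖ ≤ B * ‖x‖ :=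
    ((act (V k)).le_opNorm x).trans (mul_le_mul_of_nonneg_right (h k) (norm_nonneg x))
  gcongr

theorem opNorm_le_one_of_mem_unitary {M : Matrix ι ι ℂ} (hM : M ∈ unitary (Matrix ι ι ℂ)) :
    opNorm M ≤ 1 :=
  ContinuousLinearMap.opNorm_le_bound _ zero_le_one fun x => by
    rw [one_mul]; exact (norm_act_of_mem_unitary hM x).le

theorem phaseBlock_sub {σ : Type*} (n : ℕ) (V V' : ℕ → Matrix σ σ ℂ) (l : Fin (2 ^ n)) :
    phaseBlock n (fun k => V k - V' k) l = phaseBlock n V l - phaseBlock n V' l := by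
  simp [phaseBlock, smul_sub, Finset.sum_sub_distrib]

theorem sum_norm_mul_norm_le {σ : Type*} [Fintype σ] {E F : Type*} [SeminormedAddCommGroup E]
    [SeminormedAddCommGroup F] (v : σ → E) (w : σ → F) {B C : ℝ} (hB : 0 ≤ B) (hC : 0 ≤ C)
    (hv : ∑ l, ‖v l‖ ^ 2 ≤ B ^ 2) (hw : ∑ l, ‖w l‖ ^ 2 ≤ C ^ 2) : ∑ l, ‖v l‖ * ‖w l‖ ≤ B * C :=
  (Real.sum_mul_le_sqrt_mul_sqrt _ _ _).trans
    (mul_le_mul (Real.sqrt_le_iff.2 ⟨hB, hv⟩) (Real.sqrt_le_iff.2 ⟨hC, hw⟩) (Real.sqrt_nonneg _) hB)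

/-- Replacing unitary powers `V k` by unitaries at distance at most `ε` changes the unnormalized
output by at most `2 ε`. -/
theorem norm_act_filterMatrix_sub_le (n : ℕ) {V V' : ℕ → Matrix ι ι ℂ} (θ : Fin (2 ^ n) → ℝ)
    (hV : ∀ k, V k ∈ unitary (Matrix ι ι ℂ)) (hV' : ∀ k, V' k ∈ unitary (Matrix ι ι ℂ)) {ε : ℝ}
    (hε : ∀ k : Fin (2 ^ n), opNorm (V k - V' k) ≤ ε) (y : EuclideanSpace ℂ ι) :
    ‖act (filterMatrix n V θ) y - act (filterMatrix n V' θ) y‖ ≤ 2 * ε * ‖y‖ := by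
  have hε0 : 0 ≤ ε := (opNorm_nonneg _).trans (hε 0)
  set x := act (filterMatrix n V θ) y - act (filterMatrix n V' θ) y with hx
  have hexp : ∀ (U : ℕ → Matrix ι ι ℂ), inner ℂ x (act (filterMatrix n U θ) y) =
      ∑ l, (Real.sin (θ l) : ℂ) * inner ℂ (act (phaseBlock n U l) x) (act (phaseBlock n U l) y) := by
    intro U
    have : act (filterMatrix n U θ) y =
        ∑ l, (Real.sin (θ l) : ℂ) • act (phaseBlock n U l)ᴴ (act (phaseBlock n U l) y) := by
      simp only [act, filterMatrix, map_sum, map_smul, map_mul, sum_apply,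
        smul_apply, mul_apply_eq_comp]
    rw [this, inner_sum]
    exact Finset.sum_congr rfl fun l _ => by rw [inner_smul_right, act_conjTranspose]
  -- The difference is tested against itself, and `B l` is exchanged for `B' l` in one argument of
  -- the sesquilinear form at a time.
  have hsplit : inner ℂ x x = ∑ l, (Real.sin (θ l) : ℂ) *
      (inner ℂ (act (phaseBlock n V l) x) (act (phaseBlock n (fun k => V k - V' k) l) y) +
       inner ℂ (act (phaseBlock n (fun k => V k - V' k) l) x) (act (phaseBlock n V' l) y)) := by
    conv_lhs => rw [hx, inner_sub_right, ← hx, hexp, hexp, ← Finset.sum_sub_distrib]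
    refine Finset.sum_congr rfl fun l _ => ?_
    simp only [phaseBlock_sub, act, map_sub, sub_apply, inner_sub_left,
      inner_sub_right]
    ring
  have hone : ∀ {U : ℕ → Matrix ι ι ℂ}, (∀ k, U k ∈ unitary (Matrix ι ι ℂ)) →
      ∀ z : EuclideanSpace ℂ ι, ∑ l, ‖act (phaseBlock n U l) z‖ ^ 2 ≤ ‖z‖ ^ 2 := by
    intro U hU z
    have := sum_norm_sq_act_phaseBlock_le n U z
      fun k => opNorm_le_one_of_mem_unitary (hU k)
    rwa [one_mul] at this
  have hdiff := fun z => sum_norm_sq_act_phaseBlock_le n (fun k => V k - V' k) z hε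
  -- In each half, Cauchy–Schwarz over `l` pairs the blocks of a unitary family (factor `1`) with
  -- those of the difference (factor `ε`), so no number of outcomes enters.
  have hbound : ‖x‖ ^ 2 ≤ ‖x‖ * (ε * ‖y‖) + (ε * ‖x‖) * ‖y‖ := by
    have h1 : ‖x‖ ^ 2 = ‖inner ℂ x x‖ := by
      rw [inner_self_eq_norm_sq_to_K]; simp
    rw [h1, hsplit]
    refine (norm_sum_le _ _).trans ?_
    refine (Finset.sum_le_sum fun l _ => ?_).trans
      ((Finset.sum_add_distrib (s := Finset.univ)).le.trans (add_le_add
        (sum_norm_mul_norm_le _ _ (norm_nonneg x) (by positivity) (hone hV x) (hdiff y))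
        (sum_norm_mul_norm_le _ _ (by positivity) (norm_nonneg y) (hdiff x) (hone hV' y))))
    rw [norm_mul, Complex.norm_real, Real.norm_eq_abs]
    refine (mul_le_of_le_one_left (norm_nonneg _) (Real.abs_sin_le_one _)).trans ?_
    exact (norm_add_le _ _).trans (add_le_add (norm_inner_le_norm _ _) (norm_inner_le_norm _ _))
  rcases (norm_nonneg x).eq_or_lt with h0 | h0
  · rw [← h0]; positivity
  · nlinarith

end Circuit

/-! ### The outcome distribution of phase estimation -/

/-- The amplitude of `|l⟩` after phase estimation of an eigenvector whose eigenvalue is `μ` on the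
scale of the eigenvalue register. -/
def phaseAmplitude (n : ℕ) (μ : ℝ) (l : Fin (2 ^ n)) : ℂ :=
  ((2 : ℂ) ^ n)⁻¹ * ∑ k : Fin (2 ^ n),
    fourierKernel n k l * Complex.exp (2 * Real.pi * Complex.I * (k : ℕ) * μ / 2 ^ n)

theorem sum_norm_sq_phaseAmplitude (n : ℕ) (μ : ℝ) : ∑ l, ‖phaseAmplitude n μ l‖ ^ 2 = 1 := by
  have h := sum_norm_sq_fourier n fun k : Fin (2 ^ n) =>
    Complex.exp (2 * Real.pi * Complex.I * (k : ℕ) * μ / 2 ^ n)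
  have h1 : ∀ k : Fin (2 ^ n),
      ‖Complex.exp (2 * Real.pi * Complex.I * (k : ℕ) * μ / 2 ^ n)‖ = 1 := by
    intro k
    have : (2 * Real.pi * Complex.I * (k : ℕ) * μ / 2 ^ n : ℂ) =
        ((2 * Real.pi * (k : ℕ) * μ / 2 ^ n : ℝ) : ℂ) * Complex.I := by push_cast; ring
    rw [this, Complex.norm_exp_ofReal_mul_I]
  simp only [h1, smul_eq_mul] at h
  rw [show (∑ l, ‖phaseAmplitude n μ l‖ ^ 2) = _ from h]
  simp

theorem norm_phaseAmplitude_le_one (n : ℕ) (μ : ℝ) (l : Fin (2 ^ n)) :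
    ‖phaseAmplitude n μ l‖ ≤ 1 := by
  have h := Finset.single_le_sum (f := fun l => ‖phaseAmplitude n μ l‖ ^ 2)
    (fun l _ => sq_nonneg _) (Finset.mem_univ l)
  rw [sum_norm_sq_phaseAmplitude] at h
  exact (sq_le_one_iff₀ (norm_nonneg _)).1 h

/-- Jordan's inequality for `|y| ≤ 1/2`, and the symmetry of the sine about `π / 2` beyond. -/
theorem two_mul_le_abs_sin_pi_mul {x y : ℝ} (hx : 0 ≤ x) (hxy : x ≤ |y|) (hxy' : x ≤ 1 - |y|) :
    2 * x ≤ |Real.sin (Real.pi * y)| := by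
  have hpi := Real.pi_pos
  have key : ∀ z : ℝ, 0 ≤ z → z ≤ 1 / 2 → 2 * z ≤ Real.sin (Real.pi * z) := by
    intro z h0 h1
    have := Real.mul_le_sin (x := Real.pi * z) (by positivity) (by nlinarith)
    calc 2 * z = 2 / Real.pi * (Real.pi * z) := by field_simp
      _ ≤ _ := this
  have habs : |Real.sin (Real.pi * y)| = |Real.sin (Real.pi * |y|)| := by
    rcases abs_choice y with h | h <;> rw [h]
    rw [mul_neg, Real.sin_neg, abs_neg]
  rw [habs]
  refine le_trans ?_ (le_abs_self _)
  rcases le_total |y| (1 / 2) with h | h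
  · linarith [key |y| (abs_nonneg y) h]
  · have := key (1 - |y|) (by linarith) (by linarith)
    rw [show Real.pi * (1 - |y|) = Real.pi - Real.pi * |y| by ring, Real.sin_pi_sub] at this
    linarith

/-- The amplitude is `1 / N` times a geometric sum with ratio `z` on the unit circle. Its numerator
is at most `2`, and `|z - 1| ≥ 4 D / N` by Jordan's inequality. -/
theorem norm_phaseAmplitude_mul_le (n : ℕ) (μ : ℝ) (l : Fin (2 ^ n)) {D : ℝ} (hD0 : 0 ≤ D)
    (hD : D ≤ |μ - (l : ℕ)|) (hD' : D ≤ 2 ^ n - |μ - (l : ℕ)|) :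
    ‖phaseAmplitude n μ l‖ * (2 * D) ≤ 1 := by
  have hN : (0 : ℝ) < 2 ^ n := by positivity
  set x : ℝ := 2 * Real.pi * (μ - (l : ℕ)) / 2 ^ n with hx
  set z : ℂ := Complex.exp (Complex.I * x) with hz
  have hterm : ∀ k : Fin (2 ^ n), fourierKernel n k l *
      Complex.exp (2 * Real.pi * Complex.I * (k : ℕ) * μ / 2 ^ n) = z ^ (k : ℕ) := by
    intro k
    rw [fourierKernel, ← Complex.exp_add, hz, ← Complex.exp_nat_mul, hx]
    congr 1
    push_cast
    ring
  have hα : ‖phaseAmplitude n μ l‖ = (2 ^ n)⁻¹ * ‖∑ k ∈ Finset.range (2 ^ n), z ^ k‖ := by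
    rw [phaseAmplitude, norm_mul]
    simp_rw [hterm]
    rw [Fin.sum_univ_eq_sum_range (fun k => z ^ k)]
    simp
  have hgeom : ‖∑ k ∈ Finset.range (2 ^ n), z ^ k‖ * ‖z - 1‖ ≤ 2 := by
    rw [← norm_mul, geom_sum_mul]
    have hz1 : ‖z‖ = 1 := by rw [hz, mul_comm]; exact Complex.norm_exp_ofReal_mul_I x
    refine (norm_sub_le _ _).trans ?_
    rw [norm_pow, hz1]
    norm_num
  have hsin : 4 * (D / 2 ^ n) ≤ ‖z - 1‖ := by
    rw [hz, Complex.norm_exp_I_mul_ofReal_sub_one, Real.norm_eq_abs, abs_mul, abs_two]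
    have h1 : x / 2 = Real.pi * ((μ - (l : ℕ)) / 2 ^ n) := by rw [hx]; ring
    rw [h1]
    have h2 : |(μ - (l : ℕ)) / 2 ^ n| = |μ - (l : ℕ)| / 2 ^ n := by rw [abs_div, abs_of_pos hN]
    have := two_mul_le_abs_sin_pi_mul (x := D / 2 ^ n) (y := (μ - (l : ℕ)) / 2 ^ n) (by positivity)
      (by rw [h2]; gcongr)
      (by rw [h2, ← div_self hN.ne', ← sub_div]; gcongr)
    linarith
  rw [hα]
  set S := ‖∑ k ∈ Finset.range (2 ^ n), z ^ k‖ with hS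
  have h3 : S * (4 * (D / 2 ^ n)) ≤ 2 := (mul_le_mul_of_nonneg_left hsin (norm_nonneg _)).trans hgeom
  calc (2 ^ n)⁻¹ * S * (2 * D) = S * (4 * (D / 2 ^ n)) / 2 := by ring
    _ ≤ 1 := by linarith

/-- The distance of `μ` and `l` on the circle of length `2 ^ n`. -/
def circleDist (n : ℕ) (μ : ℝ) (l : Fin (2 ^ n)) : ℝ :=
  min |μ - (l : ℕ)| (2 ^ n - |μ - (l : ℕ)|)

/-- An integer lower bound for `circleDist n μ l`, where `m = ⌊μ⌋`. -/
def circleIndex (n m : ℕ) (l : Fin (2 ^ n)) : ℕ :=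
  if (l : ℕ) ≤ m then m - l else min (l - m - 1) (2 ^ n + m - l)

/-- A bound for the contribution of the outcomes at distance about `k` to the mean error. -/
def tailBound (k : ℕ) : ℝ := if k = 0 then 1 / 2 else 1 / (4 * k)

theorem tailBound_nonneg (k : ℕ) : 0 ≤ tailBound k := by
  rw [tailBound]; split_ifs <;> positivity

/-- As `μ` lies in the lower half of the circle, the way around is never shorter for `l ≤ μ`; it has
to be considered only for `l > μ`. -/
theorem circleIndex_le_circleDist {n : ℕ} {μ : ℝ} (h0 : 0 ≤ μ) (h1 : μ ≤ 2 ^ n / 2)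
    (l : Fin (2 ^ n)) : (circleIndex n ⌊μ⌋₊ l : ℝ) ≤ circleDist n μ l := by
  have hm : (⌊μ⌋₊ : ℝ) ≤ μ := Nat.floor_le h0
  have hm' : μ < ⌊μ⌋₊ + 1 := Nat.lt_floor_add_one μ
  have hl : ((l : ℕ) : ℝ) < 2 ^ n := by exact_mod_cast l.isLt
  have hl0 : (0 : ℝ) ≤ (l : ℕ) := Nat.cast_nonneg _
  rw [circleIndex, circleDist]
  split_ifs with h
  · have h' : ((l : ℕ) : ℝ) ≤ ⌊μ⌋₊ := by exact_mod_cast h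
    rw [abs_of_nonneg (by linarith), Nat.cast_sub h]
    exact le_min (by linarith) (by linarith)
  · push Not at h
    have h' : (⌊μ⌋₊ : ℝ) + 1 ≤ (l : ℕ) := by exact_mod_cast h
    rw [abs_of_nonpos (by linarith)]
    refine le_min ?_ ?_
    · refine (Nat.cast_le.2 (min_le_left _ _)).trans ?_
      rw [Nat.sub_sub, Nat.cast_sub h]
      push_cast
      linarith
    · refine (Nat.cast_le.2 (min_le_right _ _)).trans ?_
      rw [Nat.cast_sub (by have := l.isLt; omega)]
      push_cast
      linarith

theorem circleDist_nonneg {n : ℕ} {μ : ℝ} (h0 : 0 ≤ μ) (h1 : μ ≤ 2 ^ n / 2) (l : Fin (2 ^ n)) :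
    0 ≤ circleDist n μ l :=
  (Nat.cast_nonneg _).trans (circleIndex_le_circleDist h0 h1 l)

/-- From `α ≤ 1` and `2 α D ≤ 1`: one always has `α² D ≤ 1/2`, and for `k ≥ 1` also `α² D ≤ 1 / (4
D) ≤ 1 / (4 k)`. -/
theorem norm_sq_phaseAmplitude_mul_circleDist_le {n : ℕ} {μ : ℝ} (h0 : 0 ≤ μ) (h1 : μ ≤ 2 ^ n / 2)
    (l : Fin (2 ^ n)) :
    ‖phaseAmplitude n μ l‖ ^ 2 * circleDist n μ l ≤ tailBound (circleIndex n ⌊μ⌋₊ l) := by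
  have hD := circleDist_nonneg h0 h1 l
  have hk := circleIndex_le_circleDist h0 h1 l
  have hα0 := norm_nonneg (phaseAmplitude n μ l)
  have hα1 := norm_phaseAmplitude_le_one n μ l
  have hα := norm_phaseAmplitude_mul_le n μ l hD (min_le_left _ _) (min_le_right _ _)
  set α := ‖phaseAmplitude n μ l‖
  set D := circleDist n μ l
  set k := circleIndex n ⌊μ⌋₊ l
  rw [tailBound]
  split_ifs with hk0
  · nlinarith
  · have hkpos : (0 : ℝ) < k := by exact_mod_cast Nat.pos_of_ne_zero hk0
    have hDpos : 0 < D := hkpos.trans_le hk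
    rw [le_div_iff₀ (by positivity)]
    calc α ^ 2 * D * (4 * k) ≤ α ^ 2 * D * (4 * D) := by gcongr
      _ = (α * (2 * D)) ^ 2 := by ring
      _ ≤ 1 := pow_le_one₀ (by positivity) hα

theorem sum_tailBound_circleIndex_le {n m : ℕ} (hm : m < 2 ^ n) :
    ∑ l : Fin (2 ^ (n + 1)), tailBound (circleIndex (n + 1) m l) ≤
      2 * ∑ k ∈ Finset.range (2 ^ n), tailBound k := by
  have hpow : 2 ^ (n + 1) = 2 * 2 ^ n := pow_succ' 2 n
  have hmaps : ∀ l ∈ (Finset.univ : Finset (Fin (2 ^ (n + 1)))),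
      circleIndex (n + 1) m l ∈ Finset.range (2 ^ n) := by
    intro l _
    have := l.isLt
    rw [Finset.mem_range, circleIndex]
    -- For `l > m` the two entries of the minimum add up to `2^(n+1) - 1`, so the smaller one is
    -- below `2^n`.
    split_ifs <;> omega
  rw [← Finset.sum_fiberwise_of_maps_to hmaps, Finset.mul_sum]
  refine Finset.sum_le_sum fun k hk => ?_
  have hcard : (Finset.univ.filter fun l : Fin (2 ^ (n + 1)) => circleIndex (n + 1) m l = k).card ≤ 2 := by
    rw [← Finset.card_map Fin.valEmbedding]
    -- Each index occurs at most once to the right of `m` and once to the left, the latter directly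
    -- or, for `k > m`, around the circle.
    refine (Finset.card_le_card (t := {m + 1 + k, if k ≤ m then m - k else 2 ^ (n + 1) + m - k})
      fun x hx => ?_).trans Finset.card_le_two
    simp only [Finset.mem_map, Finset.mem_filter, Finset.mem_univ, true_and,
      Fin.valEmbedding_apply] at hx
    obtain ⟨l, hl, rfl⟩ := hx
    have hlt := l.isLt
    rw [Finset.mem_range] at hk
    rw [Finset.mem_insert, Finset.mem_singleton]
    rw [circleIndex] at hl
    split_ifs at hl ⊢ <;> omega
  calc ∑ l ∈ Finset.univ.filter (fun l : Fin (2 ^ (n + 1)) => circleIndex (n + 1) m l = k),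
        tailBound (circleIndex (n + 1) m l)
      = ∑ l ∈ Finset.univ.filter (fun l : Fin (2 ^ (n + 1)) => circleIndex (n + 1) m l = k), tailBound k :=
        Finset.sum_congr rfl fun l hl => by rw [(Finset.mem_filter.1 hl).2]
    _ = (Finset.univ.filter fun l : Fin (2 ^ (n + 1)) => circleIndex (n + 1) m l = k).card * tailBound k := by
        rw [Finset.sum_const, nsmul_eq_mul]
    _ ≤ 2 * tailBound k :=
        mul_le_mul_of_nonneg_right (by exact_mod_cast hcard) (tailBound_nonneg k)

/-- Dyadic blocks: the indices from `2^m` to `2^(m+1) - 1` are `2^m` terms of size at most `1 / (4 ·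
2^m)`. -/
theorem sum_tailBound_range_two_pow_le (m : ℕ) :
    ∑ k ∈ Finset.range (2 ^ m), tailBound k ≤ 1 / 2 + m / 4 := by
  induction m with
  | zero => simp [tailBound]
  | succ m ih =>
    rw [pow_succ, mul_two, Finset.sum_range_add]
    have hpow : (0 : ℝ) < 2 ^ m := by positivity
    have : ∑ x ∈ Finset.range (2 ^ m), tailBound (2 ^ m + x) ≤ 1 / 4 := by
      refine (Finset.sum_le_card_nsmul _ _ (1 / (4 * 2 ^ m)) fun x _ => ?_).trans ?_
      · rw [tailBound, if_neg (by positivity)]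
        push_cast
        gcongr
        linarith [(Nat.cast_nonneg x : (0 : ℝ) ≤ x)]
      · rw [Finset.card_range, nsmul_eq_mul]
        push_cast
        apply le_of_eq
        field_simp
    push_cast
    linarith

/-- The mean distance between the scaled eigenvalue and the outcome of phase estimation grows only
linearly in the number of qubits. -/
theorem sum_norm_sq_phaseAmplitude_mul_circleDist_le {n : ℕ} {μ : ℝ} (h0 : 0 ≤ μ)
    (h1 : μ < 2 ^ (n + 1) / 2) :
    ∑ l, ‖phaseAmplitude (n + 1) μ l‖ ^ 2 * circleDist (n + 1) μ l ≤ 1 + n / 2 := by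
  have hm : ⌊μ⌋₊ < 2 ^ n := by
    rw [Nat.floor_lt h0]
    push_cast
    rwa [pow_succ, mul_div_cancel_right₀ _ two_ne_zero] at h1
  have h2 := sum_tailBound_circleIndex_le hm
  have h3 := sum_tailBound_range_two_pow_le n
  calc _ ≤ ∑ l, tailBound (circleIndex (n + 1) ⌊μ⌋₊ l) :=
        Finset.sum_le_sum fun l _ => norm_sq_phaseAmplitude_mul_circleDist_le h0 h1.le l
    _ ≤ _ := by linarith

/-- After multiplication by `μ`, the clipped inverse changes by at most `|μ - l|`. For outcomes that
wrap around, the change is at most `a ≤ μ`, and `μ` is at most the distance the other way around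
because `l < 2^n`. Clipping keeps small `l` harmless. -/
theorem abs_div_max_sub_div_le {n : ℕ} {a μ : ℝ} (ha : 0 < a) (haμ : a ≤ μ) (hμ : μ ≤ 2 ^ n / 2)
    (l : Fin (2 ^ n)) : |a / max ((l : ℕ) : ℝ) a - a / μ| ≤ circleDist n μ l / μ := by
  have hl : ((l : ℕ) : ℝ) < 2 ^ n := by exact_mod_cast l.isLt
  have hl0 : (0 : ℝ) ≤ (l : ℕ) := Nat.cast_nonneg _
  have hμ0 : 0 < μ := ha.trans_le haμ
  rw [circleDist]
  set x : ℝ := ((l : ℕ) : ℝ)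
  rw [le_div_iff₀ hμ0, ← abs_of_pos hμ0, ← abs_mul, abs_of_pos hμ0, sub_mul,
    div_mul_cancel₀ a hμ0.ne']
  have hM : 0 < max x a := ha.trans_le (le_max_right _ _)
  rcases le_total x μ with h | h
  · rw [abs_of_nonneg (sub_nonneg.2 h)]
    have h2 : a ≤ a / max x a * μ := by
      rw [div_mul_eq_mul_div, le_div_iff₀ hM]
      exact mul_le_mul_of_nonneg_left (max_le h haμ) ha.le
    have h3 : a / max x a * μ - a ≤ μ - x := by
      rcases le_total x a with h4 | h4
      · rw [max_eq_right h4, div_self ha.ne']; linarith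
      · rw [max_eq_left h4, div_mul_eq_mul_div, sub_le_iff_le_add,
          div_le_iff₀ (ha.trans_le h4)]
        nlinarith
    rw [abs_of_nonneg (sub_nonneg.2 h2)]
    exact le_min h3 (by linarith)
  · have hx0 : 0 < x := hμ0.trans_le h
    rw [max_eq_left (haμ.trans h), abs_of_nonpos (sub_nonpos.2 h), abs_of_nonpos]
    · have h5 : 0 < a / x * μ := by positivity
      refine le_min ?_ (by linarith)
      have h6 : a - a / x * μ = a / x * (x - μ) := by field_simp
      have h7 : a / x ≤ 1 := (div_le_one hx0).2 (haμ.trans h)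
      nlinarith
    · rw [sub_nonpos, div_mul_eq_mul_div, div_le_iff₀ hx0]
      exact mul_le_mul_of_nonneg_left h ha.le

/-- The relative error of the inverse that phase estimation followed by approximate inversion
realizes. -/
theorem abs_sum_norm_sq_phaseAmplitude_mul_sub_le {n : ℕ} {a κ μ ε : ℝ} (ha : 0 < a) (haμ : a ≤ μ)
    (hμκ : μ ≤ κ * a) (hμ : μ < 2 ^ (n + 1) / 2) (s : Fin (2 ^ (n + 1)) → ℝ)
    (hs : ∀ l, |s l - a / max ((l : ℕ) : ℝ) a| ≤ ε) :
    |∑ l, s l * ‖phaseAmplitude (n + 1) μ l‖ ^ 2 - a / μ| ≤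
      (κ * ε + (1 + n / 2) / a) * (a / μ) := by
  have hμ0 : 0 < μ := ha.trans_le haμ
  have hε : 0 ≤ ε := (abs_nonneg _).trans (hs 0)
  set P : Fin (2 ^ (n + 1)) → ℝ := fun l => ‖phaseAmplitude (n + 1) μ l‖ ^ 2 with hP
  have hP0 : ∀ l, 0 ≤ P l := fun l => sq_nonneg _
  have hP1 : ∑ l, P l = 1 := sum_norm_sq_phaseAmplitude (n + 1) μ
  have h1 : ∑ l, s l * P l - a / μ = ∑ l, (s l - a / μ) * P l := by
    simp_rw [sub_mul]
    rw [Finset.sum_sub_distrib, ← Finset.mul_sum, hP1, mul_one]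
  have h2 : ∀ l, |(s l - a / μ) * P l| ≤ ε * P l + P l * circleDist (n + 1) μ l / μ := by
    intro l
    rw [abs_mul, abs_of_nonneg (hP0 l)]
    have h3 := abs_sub_le (s l) (a / max ((l : ℕ) : ℝ) a) (a / μ)
    have h4 := abs_div_max_sub_div_le ha haμ hμ.le l
    have h5 := hs l
    calc |s l - a / μ| * P l ≤ (ε + circleDist (n + 1) μ l / μ) * P l :=
          mul_le_mul_of_nonneg_right (by linarith) (hP0 l)
      _ = _ := by ring
  rw [h1]
  calc |∑ l, (s l - a / μ) * P l| ≤ ∑ l, (ε * P l + P l * circleDist (n + 1) μ l / μ) :=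
        (Finset.abs_sum_le_sum_abs _ _).trans (Finset.sum_le_sum fun l _ => h2 l)
    _ = ε + (∑ l, P l * circleDist (n + 1) μ l) / μ := by
        rw [Finset.sum_add_distrib, ← Finset.mul_sum, hP1, mul_one, Finset.sum_div]
    _ ≤ κ * ε * (a / μ) + (1 + n / 2) / μ := by
        refine add_le_add ?_ (div_le_div_of_nonneg_right
          (sum_norm_sq_phaseAmplitude_mul_circleDist_le hμ0.le hμ) hμ0.le)
        -- Since `a / μ ≥ 1 / κ`, an absolute error `ε` is a relative error of at most `κ ε`.
        rw [← mul_div_assoc, le_div_iff₀ hμ0]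
        nlinarith
    _ = _ := by field_simp

/-! ### Functions of a Hermitian matrix -/

section Spectral

variable {ι : Type*} [Fintype ι] [DecidableEq ι] {A : Matrix ι ι ℂ}

/-- The matrix with the eigenvectors of `A` and the eigenvalues `v`. -/
def withEigenvalues (hA : A.IsHermitian) (v : ι → ℂ) : Matrix ι ι ℂ :=
  Unitary.conjStarAlgAut ℂ (Matrix ι ι ℂ) hA.eigenvectorUnitary (Matrix.diagonal v)

theorem withEigenvalues_eigenvalues (hA : A.IsHermitian) :
    withEigenvalues hA (fun j => (hA.eigenvalues j : ℂ)) = A :=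
  hA.spectral_theorem.symm

theorem withEigenvalues_mul (hA : A.IsHermitian) (v w : ι → ℂ) :
    withEigenvalues hA v * withEigenvalues hA w = withEigenvalues hA (fun j => v j * w j) := by
  rw [withEigenvalues, withEigenvalues, ← map_mul, Matrix.diagonal_mul_diagonal, withEigenvalues]

theorem withEigenvalues_one (hA : A.IsHermitian) : withEigenvalues hA (fun _ => 1) = 1 := by
  rw [withEigenvalues, Matrix.diagonal_one, map_one]

theorem withEigenvalues_smul (hA : A.IsHermitian) (c : ℂ) (v : ι → ℂ) :
    c • withEigenvalues hA v = withEigenvalues hA (fun j => c * v j) := by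
  rw [withEigenvalues, withEigenvalues, ← map_smul, ← Matrix.diagonal_smul]
  rfl

theorem withEigenvalues_sum (hA : A.IsHermitian) {σ : Type*} (s : Finset σ) (v : σ → ι → ℂ) :
    ∑ l ∈ s, withEigenvalues hA (v l) = withEigenvalues hA (fun j => ∑ l ∈ s, v l j) := by
  simp_rw [withEigenvalues, ← map_sum]
  congr 1
  ext i j
  by_cases h : i = j
  · subst h; simp [Matrix.sum_apply]
  · simp [Matrix.sum_apply, h]

theorem withEigenvalues_sub (hA : A.IsHermitian) (v w : ι → ℂ) :
    withEigenvalues hA v - withEigenvalues hA w = withEigenvalues hA (fun j => v j - w j) := by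
  simp_rw [withEigenvalues, ← map_sub, Matrix.diagonal_sub]

theorem conjTranspose_withEigenvalues (hA : A.IsHermitian) (v : ι → ℂ) :
    (withEigenvalues hA v)ᴴ = withEigenvalues hA (fun j => (starRingEnd ℂ) (v j)) := by
  rw [withEigenvalues, ← Matrix.star_eq_conjTranspose, ← map_star, Matrix.star_eq_conjTranspose,
    Matrix.diagonal_conjTranspose]
  rfl

theorem exp_withEigenvalues (hA : A.IsHermitian) (v : ι → ℂ) :
    NormedSpace.exp (withEigenvalues hA v) = withEigenvalues hA (fun j => Complex.exp (v j)) := by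
  set U : Matrix ι ι ℂ := (hA.eigenvectorUnitary : Matrix ι ι ℂ)
  have h1 : U * star U = 1 := Unitary.coe_mul_star_self _
  have h2 : star U = U⁻¹ := (Matrix.inv_eq_right_inv h1).symm
  have h3 : IsUnit U := IsUnit.of_mul_eq_one _ h1
  have h4 : ∀ w, withEigenvalues hA w = U * Matrix.diagonal w * U⁻¹ := by
    intro w
    rw [← h2]
    rfl
  rw [h4, h4, Matrix.exp_conj _ _ h3, Matrix.exp_diagonal]
  congr 3
  funext j
  rw [Pi.coe_exp, Complex.exp_eq_exp_ℂ]

theorem evolution_eq (hA : A.IsHermitian) (s : ℝ) :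
    evolution A s =
      withEigenvalues hA (fun j => Complex.exp (Complex.I * s * hA.eigenvalues j)) := by
  rw [evolution, ← exp_withEigenvalues, ← withEigenvalues_smul, withEigenvalues_eigenvalues]

theorem evolution_mem_unitary (hA : A.IsHermitian) (s : ℝ) :
    evolution A s ∈ unitary (Matrix ι ι ℂ) := by
  have h : ∀ j, (starRingEnd ℂ) (Complex.exp (Complex.I * s * hA.eigenvalues j)) *
      Complex.exp (Complex.I * s * hA.eigenvalues j) = 1 := by
    intro j
    rw [← Complex.exp_conj, ← Complex.exp_add]
    simp
  rw [Unitary.mem_iff, Matrix.star_eq_conjTranspose, evolution_eq hA,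
    conjTranspose_withEigenvalues, withEigenvalues_mul, withEigenvalues_mul,
    ← withEigenvalues_one hA]
  exact ⟨by simp_rw [h], by simp_rw [fun j => (mul_comm _ _).trans (h j)]⟩

theorem trotterPower_mem_unitary {J : ℕ} {H : Fin J → Matrix ι ι ℂ}
    (hH : ∀ j, (H j).IsHermitian) (t : ℝ) (m k : ℕ) :
    trotterPower H t m k ∈ unitary (Matrix ι ι ℂ) := by
  have hmem : ∀ s, ∀ M ∈ List.ofFn (fun j => evolution (H j) s), M ∈ unitary (Matrix ι ι ℂ) := by
    intro s M hM
    obtain ⟨j, rfl⟩ := List.mem_ofFn.1 hM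
    exact evolution_mem_unitary (hH j) s
  refine pow_mem (pow_mem (mul_mem (list_prod_mem (hmem _)) (list_prod_mem fun M hM => ?_)) _) _
  exact hmem _ M (List.mem_reverse.1 hM)

theorem norm_act_withEigenvalues (hA : A.IsHermitian) (v : ι → ℂ) (x : EuclideanSpace ℂ ι) :
    ‖act (withEigenvalues hA v) x‖ ^ 2 =
      ∑ j, (‖v j‖ * ‖act (star (hA.eigenvectorUnitary : Matrix ι ι ℂ)) x j‖) ^ 2 := by
  have h : act (withEigenvalues hA v) x = act (hA.eigenvectorUnitary : Matrix ι ι ℂ)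
      (act (Matrix.diagonal v) (act (star (hA.eigenvectorUnitary : Matrix ι ι ℂ)) x)) := by
    rw [withEigenvalues, Unitary.conjStarAlgAut_apply, act, map_mul, map_mul, mul_apply_eq_comp,
      mul_apply_eq_comp]
  rw [h, norm_act_of_mem_unitary hA.eigenvectorUnitary.2, EuclideanSpace.norm_sq_eq]
  refine Finset.sum_congr rfl fun j _ => ?_
  rw [Matrix.ofLp_toEuclideanCLM, Matrix.mulVec_diagonal, norm_mul]

/-- Both squared norms are weighted sums over the same eigenbasis coordinates of `x`, so relative
bounds on the eigenvalues carry over to vectors. -/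
theorem norm_act_withEigenvalues_le (hA : A.IsHermitian) {v w : ι → ℂ} {r : ℝ} (hr : 0 ≤ r)
    (h : ∀ j, ‖v j‖ ≤ r * ‖w j‖) (x : EuclideanSpace ℂ ι) :
    ‖act (withEigenvalues hA v) x‖ ≤ r * ‖act (withEigenvalues hA w) x‖ := by
  refine abs_le_of_sq_le_sq' ?_ (by positivity) |>.2
  rw [mul_pow, norm_act_withEigenvalues, norm_act_withEigenvalues, Finset.mul_sum]
  refine Finset.sum_le_sum fun j _ => ?_
  rw [← mul_pow, ← mul_assoc]
  have := h j
  gcongr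

theorem inv_eq_withEigenvalues (hA : A.IsHermitian) (h : ∀ j, hA.eigenvalues j ≠ 0) :
    A⁻¹ = withEigenvalues hA (fun j => (hA.eigenvalues j : ℂ)⁻¹) := by
  apply Matrix.inv_eq_right_inv
  have h1 : ∀ j, (hA.eigenvalues j : ℂ) * (hA.eigenvalues j : ℂ)⁻¹ = 1 := fun j =>
    mul_inv_cancel₀ (by exact_mod_cast h j)
  have h2 := withEigenvalues_mul hA (fun j => (hA.eigenvalues j : ℂ))
    (fun j => (hA.eigenvalues j : ℂ)⁻¹)
  simp_rw [h1] at h2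
  rwa [withEigenvalues_eigenvalues, withEigenvalues_one] at h2

theorem isUnit_det_of_eigenvalues_ne_zero (hA : A.IsHermitian) (h : ∀ j, hA.eigenvalues j ≠ 0) :
    IsUnit A.det := by
  rw [hA.det_eq_prod_eigenvalues, isUnit_iff_ne_zero, Finset.prod_ne_zero_iff]
  intro j _
  simpa using h j

/-- Eigenvectors as test vectors give `‖A‖ ≥ λ_j` and `‖A⁻¹‖ ≥ 1 / λ_i`. -/
theorem eigenvalues_le_condNumber_mul (hA : A.IsHermitian) (h : ∀ j, 0 < hA.eigenvalues j)
    (i j : ι) : hA.eigenvalues j ≤ condNumber A * hA.eigenvalues i := by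
  have hdet := isUnit_det_of_eigenvalues_ne_zero hA fun j => (h j).ne'
  have hact : ∀ j, A *ᵥ (hA.eigenvectorBasis j).ofLp =
      (hA.eigenvalues j : ℂ) • (hA.eigenvectorBasis j).ofLp := by
    intro j
    rw [hA.mulVec_eigenvectorBasis]
    ext k
    simp
  have hnorm : ∀ j, ‖hA.eigenvectorBasis j‖ = 1 := fun j => hA.eigenvectorBasis.orthonormal.1 j
  have h1 : hA.eigenvalues j ≤ opNorm A := by
    have := norm_mulVec_le A (hA.eigenvectorBasis j)
    rwa [hact, WithLp.toLp_smul, WithLp.toLp_ofLp, norm_smul, hnorm, mul_one, mul_one,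
      Complex.norm_real, Real.norm_eq_abs, abs_of_pos (h j)] at this
  have h2 : 1 ≤ hA.eigenvalues i * opNorm A⁻¹ := by
    have h3 := norm_mulVec_le A⁻¹ (WithLp.toLp 2 (A *ᵥ (hA.eigenvectorBasis i).ofLp))
    have h4 : A⁻¹ *ᵥ (A *ᵥ (hA.eigenvectorBasis i).ofLp) = (hA.eigenvectorBasis i).ofLp := by
      rw [Matrix.mulVec_mulVec, Matrix.nonsing_inv_mul _ hdet, Matrix.one_mulVec]
    rw [WithLp.ofLp_toLp, h4, hact, WithLp.toLp_smul, WithLp.toLp_ofLp, norm_smul, hnorm, mul_one,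
      Complex.norm_real, Real.norm_eq_abs, abs_of_pos (h i)] at h3
    linarith
  calc hA.eigenvalues j ≤ opNorm A * 1 := by linarith
    _ ≤ opNorm A * (hA.eigenvalues i * opNorm A⁻¹) :=
        mul_le_mul_of_nonneg_left h2 (opNorm_nonneg A)
    _ = _ := by rw [condNumber]; ring

theorem phaseBlock_evolution (hA : A.IsHermitian) (n : ℕ) (t : ℝ) (l : Fin (2 ^ n)) :
    phaseBlock n (fun k => evolution A (t * k)) l = withEigenvalues hA
      (fun j => phaseAmplitude n (scaledEigenvalue n t (hA.eigenvalues j)) l) := by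
  simp_rw [phaseBlock, evolution_eq hA, withEigenvalues_smul, withEigenvalues_sum,
    withEigenvalues_smul]
  congr 1
  funext j
  rw [phaseAmplitude]
  congr 1
  refine Finset.sum_congr rfl fun k _ => ?_
  congr 2
  have : (Real.pi : ℂ) ≠ 0 := by exact_mod_cast Real.pi_ne_zero
  have h2 : (2 : ℂ) ^ n ≠ 0 := pow_ne_zero _ two_ne_zero
  rw [scaledEigenvalue]
  push_cast
  field_simp

theorem filterMatrix_evolution (hA : A.IsHermitian) (n : ℕ) (t : ℝ) (θ : Fin (2 ^ n) → ℝ) :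
    filterMatrix n (fun k => evolution A (t * k)) θ = withEigenvalues hA (fun j =>
      ((∑ l, Real.sin (θ l) *
        ‖phaseAmplitude n (scaledEigenvalue n t (hA.eigenvalues j)) l‖ ^ 2 : ℝ) : ℂ)) := by
  simp_rw [filterMatrix, phaseBlock_evolution hA, conjTranspose_withEigenvalues,
    withEigenvalues_mul, withEigenvalues_smul, withEigenvalues_sum]
  congr 1
  funext j
  push_cast
  refine Finset.sum_congr rfl fun l _ => ?_
  rw [Complex.conj_mul']

end Spectral

/-! ### The size of the eigenvalue register -/

/-- The argument `X` of the logarithm satisfies `ε_R (X + 1) = 4 κ²`, and rounding up makes the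
power of two exceed `X`. -/
theorem four_mul_sq_lt_mul_two_pow_eigBitsThird {κ εR : ℝ} (hκ : 1 ≤ κ) (h0 : 0 < εR)
    (h1 : εR < 1) : 4 * κ ^ 2 < εR * (2 ^ eigBitsThird κ εR + 1) := by
  set X : ℝ := 2 * (2 * κ ^ 2 - εR) / εR + 1 with hX
  have hκ2 : 1 ≤ κ ^ 2 := one_le_pow₀ hκ
  have hX0 : 0 < X := by
    have : 0 < 2 * κ ^ 2 - εR := by linarith
    positivity
  have h2 : Real.logb 2 X < (eigBitsThird κ εR : ℕ) := by
    rw [eigBitsThird]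
    push_cast
    exact Nat.lt_floor_add_one _
  have h3 : X < 2 ^ eigBitsThird κ εR := by
    rwa [Real.logb_lt_iff_lt_rpow one_lt_two hX0, Real.rpow_natCast] at h2
  have h4 : εR * (X + 1) = 4 * κ ^ 2 := by rw [hX]; field_simp; ring
  rw [← h4]
  gcongr

theorem twelve_mul_add_four_le {q : ℕ} (hq : 2 ≤ q) : 12 * q + 4 ≤ 7 * 2 ^ q := by
  induction q, hq using Nat.le_induction with
  | base => norm_num
  | succ q hq ih => rw [pow_succ]; omega

/-- The total relative error of eigenvalue inversion. -/
theorem mul_angleError_add_le {κ εR : ℝ} (hκ : 1 ≤ κ) (h0 : 0 < εR) (h1 : εR < 1) {n : ℕ}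
    (hn : n + 1 = eigBits κ εR) :
    κ * angleError κ εR + (1 + n / 2) / cutoff κ εR ≤ 21 / 25 * εR := by
  have hQ := four_mul_sq_lt_mul_two_pow_eigBitsThird hκ h0 h1
  have hκ2 : 1 ≤ κ ^ 2 := one_le_pow₀ hκ
  rw [eigBits] at hn
  rw [cutoff, mul_comm 2, pow_mul]
  set q := eigBitsThird κ εR
  set Q : ℝ := 2 ^ q with hQdef
  have hQ3 : 3 < Q := by nlinarith
  have hq : 2 ≤ q := by
    by_contra! hlt
    have : Q ≤ 2 ^ 1 := pow_le_pow_right₀ one_le_two (by omega)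
    linarith
  have hQ4 : 4 ≤ Q := by
    have : (2 : ℝ) ^ 2 ≤ Q := pow_le_pow_right₀ one_le_two hq
    linarith
  -- Equivalent to `κ ≤ 2 κ² - ε_R`, which follows from `κ ≤ κ²` and `ε_R < 1 ≤ κ²`.
  have hA : κ * angleError κ εR ≤ εR / 2 := by
    have hden : 0 < 2 * κ ^ 2 - εR := by linarith
    rw [angleError, ← mul_div_assoc, div_le_div_iff₀ (by positivity) two_pos]
    nlinarith [mul_nonneg h0.le (sub_nonneg.2 hκ)]
  -- With `Q = 2^q` the cutoff is `Q²`. The numerator is at most `7/8 Q`, and `ε_R (Q + 1) ≥ 4` with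
  -- `Q ≥ 4` gives `ε_R Q ≥ 16/5`; finally `7/8 ≤ 17/50 · 16/5`.
  have hB : (1 + (n : ℝ) / 2) / Q ^ 2 ≤ 17 / 50 * εR := by
    have hnR : (n : ℝ) = 3 * q - 1 := by
      have : ((n + 1 : ℕ) : ℝ) = ((3 * q : ℕ) : ℝ) := by rw [hn]
      push_cast at this
      linarith
    have hlin : 12 * (q : ℝ) + 4 ≤ 7 * Q := by
      rw [hQdef]; exact_mod_cast twelve_mul_add_four_le hq
    rw [hnR, div_le_iff₀ (by positivity)]
    have h4 : 4 ≤ εR * (Q + 1) := by linarith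
    have h5 : 1 + (3 * (q : ℝ) - 1) / 2 ≤ 7 / 8 * Q := by linarith
    have h6 : 16 / 5 ≤ εR * Q := by nlinarith
    nlinarith
  linarith

/-- With `Q` a third of the register this reads `κ Q² < Q³ / 2`, and `4 κ² < Q + 1 < Q²`. It
confines the scaled eigenvalues to the lower half of the circle. -/
theorem mul_cutoff_lt {κ εR : ℝ} (hκ : 1 ≤ κ) (h0 : 0 < εR) (h1 : εR < 1) :
    κ * cutoff κ εR < 2 ^ eigBits κ εR / 2 := by
  have hQ := four_mul_sq_lt_mul_two_pow_eigBitsThird hκ h0 h1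
  rw [cutoff, eigBits, mul_comm 2, pow_mul, mul_comm 3, pow_mul]
  set Q : ℝ := 2 ^ eigBitsThird κ εR
  have hQ0 : 0 < Q := by positivity
  have h2 : 4 * κ ^ 2 < Q + 1 := by nlinarith
  have h3 : 3 < Q := by nlinarith
  have h4 : 2 * κ < Q := by nlinarith
  nlinarith [pow_pos hQ0 2]

/-- The sine is 1-Lipschitz, so the error of the angle bounds that of the amplitude; below the
cutoff the amplitude `1` is exact. -/
theorem abs_sin_rotationAngle_sub_le {n d : ℕ} {a ε : ℝ} (ha : 0 < a)
    (h : ∀ x ∈ Set.Icc a (2 ^ n - 1), |Real.arcsin (a / x) - inversionAngle d a a x| ≤ ε)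
    (hε : 0 ≤ ε) (l : Fin (2 ^ n)) :
    |Real.sin (rotationAngle n d a a l) - a / max ((l : ℕ) : ℝ) a| ≤ ε := by
  have hl : ((l : ℕ) : ℝ) + 1 ≤ 2 ^ n := by exact_mod_cast l.isLt
  rw [rotationAngle]
  split_ifs with hal
  · have hl0 : (0 : ℝ) < (l : ℕ) := ha.trans_le hal
    have h1 : a / (l : ℕ) ≤ 1 := (div_le_one hl0).2 hal
    have h2 : 0 ≤ a / ((l : ℕ) : ℝ) := by positivity
    have h3 := h (l : ℕ) ⟨hal, by linarith⟩
    rw [max_eq_left hal]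
    conv_lhs => rw [← Real.sin_arcsin (by linarith : -1 ≤ a / ((l : ℕ) : ℝ)) h1]
    rw [abs_sub_comm] at h3
    exact (Real.abs_sin_sub_sin_le _ _).trans h3
  · rw [max_eq_right (not_le.1 hal).le, Real.sin_pi_div_two, div_self ha.ne', sub_self, abs_zero]
    exact hε

/-! ### Error bounds for eigenvalue inversion and Hamiltonian simulation -/

section Errors

variable {ι : Type*} [Fintype ι] [DecidableEq ι] {A : Matrix ι ι ℂ}

theorem scaledEigenvalue_pos_iff {n : ℕ} {t lam : ℝ} (ht : 0 < t) :
    0 < scaledEigenvalue n t lam ↔ 0 < lam := by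
  have h : scaledEigenvalue n t lam = 2 ^ n * t / (2 * Real.pi) * lam := by
    rw [scaledEigenvalue]; ring
  rw [h]
  exact mul_pos_iff_of_pos_left (by have := Real.pi_pos; positivity)

/-- The exact solution, in terms of the scaled eigenvalues. -/
theorem exactSolution_eq (hA : A.IsHermitian) {n : ℕ} {t a : ℝ} (ht : 0 < t) (ha : 0 < a)
    (h : ∀ j, 0 < hA.eigenvalues j) (b : EuclideanSpace ℂ ι) :
    exactSolution A b = normalized (act (withEigenvalues hA
      (fun j => ((a / scaledEigenvalue n t (hA.eigenvalues j) : ℝ) : ℂ))) b) := by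
  set r : ℝ := 2 * Real.pi * a / (2 ^ n * t) with hr
  have hr0 : 0 < r := by have := Real.pi_pos; positivity
  have h1 : withEigenvalues hA (fun j => ((a / scaledEigenvalue n t (hA.eigenvalues j) : ℝ) : ℂ)) =
      (r : ℂ) • A⁻¹ := by
    rw [inv_eq_withEigenvalues hA fun j => (h j).ne', withEigenvalues_smul]
    congr 1
    funext j
    rw [← Complex.ofReal_inv, ← Complex.ofReal_mul, hr, scaledEigenvalue]
    congr 1
    have := (h j).ne'
    have := Real.pi_pos
    field_simp
  rw [h1, act, map_smul, smul_apply, normalized_smul hr0]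
  rfl

/-- If `u` is the exact unnormalized solution, `v` differs from it by the error of eigenvalue
inversion, and `w` differs from `v` by the error of Hamiltonian simulation, then the quadratic term
absorbs the amplification of the latter by the condition number. -/
theorem norm_normalized_sub_le_add {σ : Type*} [Fintype σ] {u v w : EuclideanSpace ℂ σ} {κ εR εA β : ℝ} (hκ : 0 ≤ κ)
    (h0 : 0 < εR) (h1 : εR < 1) (hA : 0 ≤ εA) (huv : ‖u - v‖ ≤ 21 / 25 * εR * ‖u‖)
    (hβ : β ≤ κ * ‖u‖) (hvw : ‖v - w‖ ≤ 2 * εA * β) :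
    ‖normalized u - normalized w‖ ≤
      2 * εA + εR + (25 * κ) ^ 2 / (2 / 25 * εR) * εA ^ 2 := by
  have hu0 := norm_nonneg u
  have hv0 := norm_nonneg v
  -- The defect is a perfect square over `2/25 ε_R`; this determines `K`.
  have hK : 25 * κ * εA ≤ 1 / 50 * εR + (25 * κ) ^ 2 / (2 / 25 * εR) * εA ^ 2 := by
    have : 1 / 50 * εR + (25 * κ) ^ 2 / (2 / 25 * εR) * εA ^ 2 - 25 * κ * εA =
        (εR / 25 - 25 * κ * εA) ^ 2 / (2 / 25 * εR) := by field_simp; ring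
    have h2 : 0 ≤ (εR / 25 - 25 * κ * εA) ^ 2 / (2 / 25 * εR) := by positivity
    linarith
  -- The gap between `21/25` and `49/50` pays for the factor `2 / √3` of normalization, as `(21/25)²
  -- ≤ 3/4 · (49/50)²`. The saved `ε_R / 50` goes into `hK`.
  have h2 : ‖normalized u - normalized v‖ ≤ 49 / 50 * εR := by
    apply norm_normalized_sub_le_of_sq_le (by positivity) (by linarith)
    calc ‖u - v‖ ^ 2 ≤ (21 / 25 * εR * ‖u‖) ^ 2 := by gcongr
      _ = (21 / 25) ^ 2 * (εR * ‖u‖) ^ 2 := by ring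
      _ ≤ (3 / 4 * (49 / 50) ^ 2) * (εR * ‖u‖) ^ 2 := by
          gcongr
          norm_num
      _ = _ := by ring
  have h3 : 4 / 25 * ‖u‖ ≤ ‖v‖ := by
    have h4 := norm_sub_norm_le u v
    nlinarith
  -- Normalization doubles the error to `4 κ ε_A ‖u‖`, and division by `‖v‖ ≥ 4/25 ‖u‖` yields the
  -- factor `25`.
  have h5 : ‖normalized v - normalized w‖ ≤ 25 * κ * εA := by
    rcases hv0.eq_or_lt with hv | hv
    · have hu : ‖u‖ = 0 := by linarith
      have hw : ‖v - w‖ ≤ 0 := by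
        refine hvw.trans ?_
        rw [hu, mul_zero] at hβ
        nlinarith
      rw [sub_eq_zero.1 (norm_le_zero_iff.1 hw), sub_self, norm_zero]
      positivity
    · have h6 := norm_normalized_sub_mul_le v w
      refine le_of_mul_le_mul_right (h6.trans ?_) hv
      calc 2 * ‖v - w‖ ≤ 2 * (2 * εA * β) := by gcongr
        _ ≤ 2 * (2 * εA * (κ * ‖u‖)) := by gcongr
        _ = 25 * κ * εA * (4 / 25 * ‖u‖) := by ring
        _ ≤ _ := by gcongr
  have h7 := norm_sub_le_norm_sub_add_norm_sub (normalized u) (normalized v) (normalized w)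
  linarith

/-- The errors of eigenvalue inversion and Hamiltonian simulation for a given initial state. -/
theorem norm_exactSolution_sub_output_le (hA : A.IsHermitian) {κ εR t : ℝ} (h0 : 0 < εR)
    (h1 : εR < 1) (hκ : 1 ≤ κ) (ht : 0 < t) (hpos : ∀ j, 0 < hA.eigenvalues j)
    (hlow : ∀ j, cutoff κ εR ≤ scaledEigenvalue (eigBits κ εR) t (hA.eigenvalues j))
    (hupp : ∀ j, scaledEigenvalue (eigBits κ εR) t (hA.eigenvalues j) ≤ κ * cutoff κ εR)
    {d : ℕ}
    (hd : ∀ x ∈ Set.Icc (cutoff κ εR) (2 ^ eigBits κ εR - 1),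
      |Real.arcsin (cutoff κ εR / x) - inversionAngle d (cutoff κ εR) (cutoff κ εR) x| ≤
        angleError κ εR)
    {V : ℕ → Matrix ι ι ℂ} (hV : ∀ k, V k ∈ unitary (Matrix ι ι ℂ)) {εA : ℝ}
    (hεA : ∀ k : ℕ, k < 2 ^ eigBits κ εR → opNorm (evolution A (t * k) - V k) ≤ εA)
    (b : EuclideanSpace ℂ ι) :
    ‖exactSolution A b - output (eigBits κ εR) V
        (rotationAngle (eigBits κ εR) d (cutoff κ εR) (cutoff κ εR)) b‖ ≤
      2 * εA + εR + (25 * κ) ^ 2 / (2 / 25 * εR) * εA ^ 2 := by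
  have ha : 0 < cutoff κ εR := by rw [cutoff]; positivity
  have hκ2 : 1 ≤ κ ^ 2 := one_le_pow₀ hκ
  have hang : 0 ≤ angleError κ εR :=
    div_nonneg h0.le (by linarith)
  have hhalf := mul_cutoff_lt hκ h0 h1
  obtain ⟨n, hn⟩ : ∃ n, eigBits κ εR = n + 1 :=
    ⟨3 * ⌊Real.logb 2 (2 * (2 * κ ^ 2 - εR) / εR + 1)⌋₊ + 2, by
      rw [eigBits, eigBitsThird]; ring⟩
  have herr := mul_angleError_add_le hκ h0 h1 hn.symm
  rw [hn] at hlow hupp hd hεA hhalf ⊢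
  set a := cutoff κ εR
  set θ := rotationAngle (n + 1) d a a
  set μ : ι → ℝ := fun j => scaledEigenvalue (n + 1) t (hA.eigenvalues j) with hμ
  have hμ0 : ∀ j, 0 < μ j := fun j => ha.trans_le (hlow j)
  set g : ι → ℝ := fun j => ∑ l, Real.sin (θ l) * ‖phaseAmplitude (n + 1) (μ j) l‖ ^ 2 with hg
  have hgh : ∀ j, |g j - a / μ j| ≤ 21 / 25 * εR * (a / μ j) := fun j =>
    (abs_sum_norm_sq_phaseAmplitude_mul_sub_le ha (hlow j) (hupp j) ((hupp j).trans_lt hhalf) _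
      (abs_sin_rotationAngle_sub_le ha hd hang)).trans
      (mul_le_mul_of_nonneg_right herr (div_pos ha (hμ0 j)).le)
  rw [exactSolution_eq hA (n := n + 1) ht ha hpos, output_eq]
  -- The intermediate vector is the unnormalized output for the exact evolution.
  refine norm_normalized_sub_le_add
    (v := act (filterMatrix (n + 1) (fun k => evolution A (t * k)) θ) b) (β := ‖b‖)
    (by linarith) h0 h1 ((opNorm_nonneg _).trans (hεA 0 (by positivity))) ?_ ?_ ?_
  · rw [filterMatrix_evolution hA, ← sub_apply, act, act, ← map_sub, withEigenvalues_sub]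
    refine norm_act_withEigenvalues_le hA (by positivity) (fun j => ?_) b
    rw [← Complex.ofReal_sub, Complex.norm_real, Complex.norm_real, Real.norm_eq_abs,
      Real.norm_eq_abs, abs_sub_comm, abs_of_pos (div_pos ha (hμ0 j))]
    exact hgh j
  · have hb : b = act (withEigenvalues hA fun _ => 1) b := by
      rw [withEigenvalues_one, act, map_one, one_apply_eq_self]
    conv_lhs => rw [hb]
    refine norm_act_withEigenvalues_le hA (by linarith) (fun j => ?_) b
    rw [norm_one, Complex.norm_real, Real.norm_eq_abs, abs_of_pos (div_pos ha (hμ0 j)),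
      ← mul_div_assoc, one_le_div (hμ0 j)]
    exact hupp j
  · exact norm_act_filterMatrix_sub_le (n + 1) (V := fun k => evolution A (t * k)) (V' := V) θ
      (fun k => evolution_mem_unitary hA (t * k)) hV (fun k => hεA k k.isLt) b

end Errors

end HHL

end

/-! ### The main theorem: combining the three errors -/

theorem theorem3 (κ εR : ℝ) (hεR : 0 < εR) (hεR1 : εR < 1) :
    ∃ K : ℝ, ∀ (nb : ℕ) (_ : 1 ≤ nb)
      (A : Matrix (Fin (2 ^ nb)) (Fin (2 ^ nb)) ℂ) (hA : A.IsHermitian)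
      (_ : HHL.condNumber A = κ)
      -- state preparation
      (f : ℝ → ℝ) (_ : HHL.rhs nb f ≠ 0) (p : Polynomial ℝ) (εp c : ℝ)
      (_ : ∀ x ∈ Set.Icc (0 : ℝ) 1, |f x / HHL.rhsSup nb f - p.eval x| ≤ εp)
      (_ : 0 < c) (_ : c ≤ 1)
      -- evolution time and eigenvalue inversion
      (t : ℝ) (_ : 0 < t)
      (_ : ∀ j, HHL.scaledEigenvalue (HHL.eigBits κ εR) t (hA.eigenvalues j) ∈
        Set.Icc (HHL.cutoff κ εR) (2 ^ HHL.eigBits κ εR - 1))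
      (_ : ∀ x ∈ Set.Icc (HHL.cutoff κ εR) (2 ^ HHL.eigBits κ εR - 1),
        HHL.rotationConstant hA (HHL.eigBits κ εR) t / x ∈ Set.Ioc (0 : ℝ) 1)
      (d : ℕ)
      (_ : ∀ x ∈ Set.Icc (HHL.cutoff κ εR) (2 ^ HHL.eigBits κ εR - 1),
        |Real.arcsin (HHL.rotationConstant hA (HHL.eigBits κ εR) t / x) -
          HHL.inversionAngle d (HHL.cutoff κ εR)
            (HHL.rotationConstant hA (HHL.eigBits κ εR) t) x| ≤ HHL.angleError κ εR)
      -- Hamiltonian simulation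
      (J : ℕ) (H : Fin J → Matrix (Fin (2 ^ nb)) (Fin (2 ^ nb)) ℂ)
      (_ : ∀ j, (H j).IsHermitian) (_ : A = ∑ j, H j)
      (m : ℕ → ℕ) (_ : ∀ k, 0 < m k) (εA : ℝ)
      (_ : ∀ k : ℕ, k < 2 ^ HHL.eigBits κ εR →
        HHL.opNorm (HHL.evolution A (t * k) - HHL.trotterPower H t (m k) k) ≤ εA),
      ‖HHL.exactSolution A (HHL.rhs nb f) -
          HHL.approxSolution nb (HHL.eigBits κ εR) c p H t m d (HHL.cutoff κ εR)
            (HHL.rotationConstant hA (HHL.eigBits κ εR) t)‖ ≤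
        HHL.statePrepError nb f κ εp c + 2 * εA + εR + K * εA ^ 2 := by
  
  refine ⟨(25 * κ) ^ 2 / (2 / 25 * εR), ?_⟩
  intro nb hnb A hA hcond f hf p εp c hp hc _ t ht hscaled hC d hd J H hH _ m _ εA hεA
  have ha : 0 < HHL.cutoff κ εR := by rw [HHL.cutoff]; positivity
  have hpos : ∀ j, 0 < hA.eigenvalues j := fun j =>
    (HHL.scaledEigenvalue_pos_iff ht).1 (ha.trans_le (hscaled j).1)
  obtain ⟨i, hi⟩ := exists_eq_ciInf_of_finite (f := hA.eigenvalues)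
  -- Comparing an eigenvalue with itself gives `λ ≤ κ λ`.
  have hκ : 1 ≤ κ := by
    have := HHL.eigenvalues_le_condNumber_mul hA hpos i i
    rw [hcond] at this
    exact le_of_mul_le_mul_right (by linarith) (hpos i)
  have hCi : HHL.rotationConstant hA (HHL.eigBits κ εR) t =
      HHL.scaledEigenvalue (HHL.eigBits κ εR) t (hA.eigenvalues i) := by
    rw [HHL.rotationConstant, hi]
  -- the hypotheses on `C` leave no choice but `C = a`
  have hCa : HHL.rotationConstant hA (HHL.eigBits κ εR) t = HHL.cutoff κ εR := by
    refine le_antisymm ?_ (hCi ▸ (hscaled i).1)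
    exact (div_le_one ha).1 (hC _ ⟨le_rfl, (hscaled i).1.trans (hscaled i).2⟩).2
  rw [hCa] at hCi hd ⊢
  -- As `C = a`, the smallest scaled eigenvalue is exactly `a`, so the condition number bounds all
  -- of them by `κ a`.
  have hupp : ∀ j, HHL.scaledEigenvalue (HHL.eigBits κ εR) t (hA.eigenvalues j) ≤
      κ * HHL.cutoff κ εR := by
    intro j
    have h := HHL.eigenvalues_le_condNumber_mul hA hpos i j
    rw [hcond] at h
    have hpi := Real.pi_pos
    rw [hCi, HHL.scaledEigenvalue, HHL.scaledEigenvalue, ← mul_div_assoc]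
    apply div_le_div_of_nonneg_right _ (by positivity)
    calc 2 ^ HHL.eigBits κ εR * hA.eigenvalues j * t
        ≤ 2 ^ HHL.eigBits κ εR * (κ * hA.eigenvalues i) * t := by gcongr
      _ = _ := by ring
  have hprep := HHL.norm_exactSolution_sub_preparedState_le hnb
    (HHL.isUnit_det_of_eigenvalues_ne_zero hA fun j => (hpos j).ne') (hcond ▸ hκ) hf hp hc
  rw [hcond] at hprep
  have hmain := HHL.norm_exactSolution_sub_output_le hA hεR hεR1 hκ ht hpos
    (fun j => (hscaled j).1) hupp hd
    (fun k => HHL.trotterPower_mem_unitary hH t (m k) k) hεA (HHL.preparedState nb c p)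
  have htri := norm_sub_le_norm_sub_add_norm_sub (HHL.exactSolution A (HHL.rhs nb f))
    (HHL.exactSolution A (HHL.preparedState nb c p))
    (HHL.approxSolution nb (HHL.eigBits κ εR) c p H t m d (HHL.cutoff κ εR) (HHL.cutoff κ εR))
  rw [HHL.approxSolution] at htri ⊢
  linarith
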